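/- Let $\varphi:(M^m,g)\to(N^n,h)$ be a smooth map between Riemannian manifolds that is an almost submersion, i.e. $\mathrm d\varphi_x$ is surjective for all $x$ in a dense subset of $M$. Let $\mathcal V=\mathrm{Ker}\,\mathrm d\varphi$ and let $\mathcal H=\mathcal V^{\perp}$ be its $g$-orthogonal complement. Let $\mathfrak C_\varphi=\mathrm d\varphi^{t}\circ\mathrm d\varphi$ be the Cauchy--Green tensor, so that $g(\mathfrak C_\varphi X,Y)=\varphi^*h(X,Y)$, let $e(\varphi)=\frac12|\mathrm d\varphi|^2=\frac12\,\mathrm{trace}\,\mathfrak C_\varphi$ be the energy density and $\tau(\varphi)=\mathrm{trace}\,\nabla\mathrm d\varphi$ the tension field. The $\sigma_2$-tension field of $\varphi$ is the section of $\varphi^{-1}TN$ $$\tau_{\sigma_2}(\varphi)=2\left[e(\varphi)\tau(\varphi)+\mathrm d\varphi(\mathrm{grad}\,e(\varphi))\right]-\sum_k\nabla\mathrm d\varphi(e_k,\mathfrak C_\varphi e_k)-\mathrm d\varphi(\mathrm{div}\,\mathfrak C_\varphi),$$ where $(e_k)$ is any $g$-orthonormal frame and $\mathrm{div}\,\mathfrak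 C_\varphi=\sum_k(\nabla_{e_k}\mathfrak C_\varphi)e_k$. For a function $f$ on $M$ let $\mathrm{grad}_{\varphi^*h}f=\sum_k\lambda_k^2E_k(f)E_k$, where $(E_k)$ is at each point a $g$-orthonormal basis of eigenvectors, $\mathfrak C_\varphi E_k=\lambda_k^2E_k$. Let $\sigma,\rho$ be nowhere vanishing smooth functions on $M$ such that $\overline g=\sigma^{-2}g^{\mathcal H}+\rho^{-2}g^{\mathcal V}$ is a smooth Riemannian metric on $M$ (this is automatic if $\varphi$ is a submersion), where $g^{\mathcal H}(X,Y)=g(X^{\mathcal H},Y^{\mathcal H})$ and $g^{\mathcal V}(X,Y)=g(X^{\mathcal V},Y^{\mathcal V})$. Then the $\sigma_2$-tension field $\overline\tau_{\sigma_2}(\varphi)$ of $\varphi:(M,\overline g)\to(N,h)$ is, at every point of $M$, $$\overline\tau_{\sigma_2}(\varphi)=\sigma^4\left\{\tau_{\sigma_2}(\varphi)+2e(\varphi)\,\mathrm d\varphi\left(\mathrm{grad}\ln|\sigma^{4-n}\rho^{n-m}|\right)-\mathrm d\varphi\left(\mathrm{grad}_{\varphi^*h}\ln|\sigma^{4-n}\rho^{n-m}|\right)\right\},$$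 where all quantities on the right-hand side are taken with respect to $g$ and $h$. In particular, for a conformal change of metric $\overline g=\sigma^{-2}g$ (the case $\rho=\sigma$), $$\overline\tau_{\sigma_2}(\varphi)=\sigma^4\left\{\tau_{\sigma_2}(\varphi)+2e(\varphi)\,\mathrm d\varphi\left(\mathrm{grad}\ln|\sigma^{4-m}|\right)-\mathrm d\varphi\left(\mathrm{grad}_{\varphi^*h}\ln|\sigma^{4-m}|\right)\right\}.$$ -/

import Mathlib

open Set
open scoped Manifold ContDiff

noncomputable section

namespace SigmaTwo

/-- Smooth Riemannian metrics on a smooth manifold `M` of dimension `m`. -/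
abbrev Metric (m : ℕ) (M : Type*) [TopologicalSpace M]
    [ChartedSpace (EuclideanSpace ℝ (Fin m)) M] [IsManifold (𝓡 m) ∞ M] :=
  Bundle.ContMDiffRiemannianMetric (𝓡 m) ∞ (EuclideanSpace ℝ (Fin m))
    (fun x : M => TangentSpace (𝓡 m) x)

/- In Mathlib a tangent vector at `x` is given by its coordinates in the preferred chart at `x`, so
`TangentSpace (𝓡 m) x` unfolds to `EuclideanSpace ℝ (Fin m)` and the coordinate vectors of that
chart at `x` are the standard basis. The two local objects below (the metric and an endomorphism
field near `x`) are read in the preferred chart at `x` before they are differentiated. -/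

section OneManifold

variable {m : ℕ} {M : Type*} [TopologicalSpace M] [ChartedSpace (EuclideanSpace ℝ (Fin m)) M]

/-- The coordinate vector `∂ᵢ` at `x` of the preferred chart at `x`. -/
def coordVec (x : M) (i : Fin m) : TangentSpace (𝓡 m) x :=
  (EuclideanSpace.single i (1 : ℝ) : EuclideanSpace ℝ (Fin m))

/-- The coordinate covector `dxⁱ` at `x` of the preferred chart at `x`. -/
def coordCovec (x : M) (i : Fin m) : Module.Dual ℝ (TangentSpace (𝓡 m) x) :=
  ((EuclideanSpace.proj i : EuclideanSpace ℝ (Fin m) →L[ℝ] ℝ) :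
    EuclideanSpace ℝ (Fin m) →ₗ[ℝ] ℝ)

instance finiteDimensionalTangent (x : M) : FiniteDimensional ℝ (TangentSpace (𝓡 m) x) :=
  inferInstanceAs (FiniteDimensional ℝ (EuclideanSpace ℝ (Fin m)))

instance t2Tangent (x : M) : T2Space (TangentSpace (𝓡 m) x) :=
  inferInstanceAs (T2Space (EuclideanSpace ℝ (Fin m)))

/-- The differential at `u` of the inverse of the preferred chart at `x`. -/
def chartInvDeriv (x : M) (u : EuclideanSpace ℝ (Fin m)) :
    EuclideanSpace ℝ (Fin m) →L[ℝ] TangentSpace (𝓡 m) ((extChartAt (𝓡 m) x).symm u) :=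
  mfderiv 𝓘(ℝ, EuclideanSpace ℝ (Fin m)) (𝓡 m) (extChartAt (𝓡 m) x).symm u

/-- The differential at `y` of the preferred chart at `x`. -/
def chartDeriv (x y : M) : TangentSpace (𝓡 m) y →L[ℝ] EuclideanSpace ℝ (Fin m) :=
  mfderiv (𝓡 m) 𝓘(ℝ, EuclideanSpace ℝ (Fin m)) (extChartAt (𝓡 m) x) y

/-- An endomorphism field of the tangent bundle, read in the preferred chart at `x`: the matrix
`Aᵏⱼ` as a function of the coordinates. -/
def endoInChart (A : ∀ y : M, TangentSpace (𝓡 m) y →L[ℝ] TangentSpace (𝓡 m) y) (x : M)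
    (u : EuclideanSpace ℝ (Fin m)) :
    EuclideanSpace ℝ (Fin m) →L[ℝ] EuclideanSpace ℝ (Fin m) :=
  (chartDeriv x ((extChartAt (𝓡 m) x).symm u)).comp
    ((A ((extChartAt (𝓡 m) x).symm u)).comp (chartInvDeriv x u))

/-- The differential at `x` of a function. -/
def dfun (f : M → ℝ) (x : M) : TangentSpace (𝓡 m) x →L[ℝ] ℝ :=
  mfderiv (𝓡 m) 𝓘(ℝ, ℝ) f x

variable [IsManifold (𝓡 m) ∞ M]

theorem flat_injective (g : Metric m M) (x : M) :
    Function.Injective ((ContinuousLinearMap.coeLM ℝ).comp (g.inner x).toLinearMap :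
      TangentSpace (𝓡 m) x →ₗ[ℝ] Module.Dual ℝ (TangentSpace (𝓡 m) x)) := by
  rw [injective_iff_map_eq_zero]
  intro v hv
  by_contra hne
  have h1 := g.pos x v hne
  have h2 := LinearMap.congr_fun hv v
  simp only [LinearMap.coe_comp, Function.comp_apply, ContinuousLinearMap.coeLM_apply,
    ContinuousLinearMap.coe_coe, LinearMap.zero_apply] at h2
  exact h1.ne' h2

/-- The musical isomorphism `♭ : T_xM → T_x*M`, `v ↦ g(v, ·)`. -/
def flat (g : Metric m M) (x : M) :
    TangentSpace (𝓡 m) x ≃ₗ[ℝ] Module.Dual ℝ (TangentSpace (𝓡 m) x) :=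
  LinearMap.linearEquivOfInjective _ (flat_injective g x) Subspace.dual_finrank_eq.symm

/-- The musical isomorphism `♯ : T_x*M → T_xM`. -/
def sharp (g : Metric m M) (x : M) :
    Module.Dual ℝ (TangentSpace (𝓡 m) x) ≃ₗ[ℝ] TangentSpace (𝓡 m) x :=
  (flat g x).symm

theorem inner_sharp (g : Metric m M) (x : M) (α : Module.Dual ℝ (TangentSpace (𝓡 m) x))
    (w : TangentSpace (𝓡 m) x) : g.inner x (sharp g x α) w = α w :=
  LinearMap.congr_fun ((flat g x).apply_symm_apply α) w

/-- The gradient: `g(grad f, v) = df(v)`. -/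
def grad (g : Metric m M) (f : M → ℝ) (x : M) : TangentSpace (𝓡 m) x :=
  sharp g x (dfun f x).toLinearMap

/-- The `g`-trace of a bilinear map on `T_xM`: `gⁱʲ B(∂ᵢ, ∂ⱼ) = ∑ᵢ B(∂ᵢ, (dxⁱ)♯)`, which equals
`∑ₖ B(eₖ, eₖ)` for every `g`-orthonormal basis `eₖ`. -/
def traceAt (g : Metric m M) (x : M) {W : Type*} [AddCommMonoid W]
    (B : TangentSpace (𝓡 m) x → TangentSpace (𝓡 m) x → W) : W :=
  ∑ i : Fin m, B (coordVec x i) (sharp g x (coordCovec x i))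

/-- The metric read in the preferred chart at `x`: the matrix `gᵢⱼ` as a function of the
coordinates. -/
def metricInChart (g : Metric m M) (x : M) (u : EuclideanSpace ℝ (Fin m)) :
    EuclideanSpace ℝ (Fin m) →L[ℝ] EuclideanSpace ℝ (Fin m) →L[ℝ] ℝ :=
  let G : EuclideanSpace ℝ (Fin m) →L[ℝ] EuclideanSpace ℝ (Fin m) →L[ℝ] ℝ :=
    g.inner ((extChartAt (𝓡 m) x).symm u)
  G.bilinearComp (chartInvDeriv x u) (chartInvDeriv x u)

/-- The Christoffel symbols of the Levi-Civita connection at `x`, in the preferred chart at `x`: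
`Γ(v, w) = vⁱ wʲ Γᵏᵢⱼ ∂ₖ` with `Γᵏᵢⱼ = ½ gᵏˡ (∂ᵢ gⱼₗ + ∂ⱼ gᵢₗ - ∂ₗ gᵢⱼ)`. -/
def christoffel (g : Metric m M) (x : M) (v w : TangentSpace (𝓡 m) x) : TangentSpace (𝓡 m) x :=
  let dG : EuclideanSpace ℝ (Fin m) →L[ℝ] EuclideanSpace ℝ (Fin m) →L[ℝ]
      EuclideanSpace ℝ (Fin m) →L[ℝ] ℝ :=
    fderiv ℝ (metricInChart g x) (extChartAt (𝓡 m) x x)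
  let v' : EuclideanSpace ℝ (Fin m) := v
  let w' : EuclideanSpace ℝ (Fin m) := w
  sharp g x (((1 / 2 : ℝ) • (dG v' w' + dG w' v' - (dG.flip v').flip w')).toLinearMap)

/-- The Levi-Civita covariant derivative `(∇_v A) w` of an endomorphism field `A`, that is
`(D_v A) w + Γ(v, A w) - A Γ(v, w)` in the preferred chart at `x`. -/
def covDerivEndo (g : Metric m M) (A : ∀ y : M, TangentSpace (𝓡 m) y →L[ℝ] TangentSpace (𝓡 m) y)
    (x : M) (v w : TangentSpace (𝓡 m) x) : TangentSpace (𝓡 m) x :=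
  let D : TangentSpace (𝓡 m) x :=
    fderiv ℝ (endoInChart A x) (extChartAt (𝓡 m) x x)
      (v : EuclideanSpace ℝ (Fin m)) (w : EuclideanSpace ℝ (Fin m))
  D + christoffel g x v (A x w) - A x (christoffel g x v w)

/-- The divergence `div A = trace ∇A = ∑ₖ (∇_{eₖ} A) eₖ` of an endomorphism field. -/
def divEndo (g : Metric m M) (A : ∀ y : M, TangentSpace (𝓡 m) y →L[ℝ] TangentSpace (𝓡 m) y)
    (x : M) : TangentSpace (𝓡 m) x :=
  traceAt g x (covDerivEndo g A x)

end OneManifold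

section Maps

variable {m n : ℕ}
  {M : Type*} [TopologicalSpace M] [ChartedSpace (EuclideanSpace ℝ (Fin m)) M]
  {N : Type*} [TopologicalSpace N] [ChartedSpace (EuclideanSpace ℝ (Fin n)) N]

/-- The differential of `φ` at `x`. -/
def diff (φ : M → N) (x : M) : TangentSpace (𝓡 m) x →L[ℝ] TangentSpace (𝓡 n) (φ x) :=
  mfderiv (𝓡 m) (𝓡 n) φ x

/-- `φ` is an almost submersion: it is submersive at the points of a dense subset. -/
def IsAlmostSubmersion (φ : M → N) : Prop :=
  Dense {x : M | Function.Surjective (diff (m := m) (n := n) φ x)}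

variable [IsManifold (𝓡 m) ∞ M] [IsManifold (𝓡 n) ∞ N]

/-- The first fundamental form `φ*h`. -/
def pullbackForm (h : Metric n N) (φ : M → N) (x : M) (v w : TangentSpace (𝓡 m) x) : ℝ :=
  h.inner (φ x) (diff φ x v) (diff φ x w)

/-- The adjoint `dφᵗ` of `dφ`: `g(dφᵗ y, w) = h(y, dφ w)`. -/
def diffAdjoint (g : Metric m M) (h : Metric n N) (φ : M → N) (x : M) :
    TangentSpace (𝓡 n) (φ x) →ₗ[ℝ] TangentSpace (𝓡 m) x :=
  (sharp g x).toLinearMap ∘ₗ (diff (m := m) φ x).toLinearMap.dualMap ∘ₗ (flat h (φ x)).toLinearMap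

/-- The Cauchy-Green tensor `C_φ = dφᵗ ∘ dφ`. -/
def cauchyGreen (g : Metric m M) (h : Metric n N) (φ : M → N) (x : M) :
    TangentSpace (𝓡 m) x →L[ℝ] TangentSpace (𝓡 m) x :=
  LinearMap.toContinuousLinearMap (diffAdjoint g h φ x ∘ₗ (diff φ x).toLinearMap)

theorem inner_cauchyGreen (g : Metric m M) (h : Metric n N) (φ : M → N) (x : M)
    (v w : TangentSpace (𝓡 m) x) :
    g.inner x (cauchyGreen g h φ x v) w = pullbackForm h φ x v w :=
  inner_sharp g x _ w

/-- The energy density `e(φ) = ½ |dφ|²`, with `|dφ|² = trace (dφᵗ ∘ dφ)`. -/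
def energyDensity (g : Metric m M) (h : Metric n N) (φ : M → N) (x : M) : ℝ :=
  (1 / 2) * LinearMap.trace ℝ (TangentSpace (𝓡 m) x) (cauchyGreen g h φ x).toLinearMap

/-- The second fundamental form `∇dφ(v, w) = ∇^φ_v (dφ w) - dφ(∇_v w)`, that is
`D²φ(v, w) - dφ(Γ(v, w)) + Γ^N(dφ v, dφ w)` in the preferred charts at `x` and `φ x`. -/
def secondFundamentalForm (g : Metric m M) (h : Metric n N) (φ : M → N) (x : M)
    (v w : TangentSpace (𝓡 m) x) : TangentSpace (𝓡 n) (φ x) :=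
  let D2 : TangentSpace (𝓡 n) (φ x) :=
    fderiv ℝ (fderiv ℝ (writtenInExtChartAt (𝓡 m) (𝓡 n) x φ)) (extChartAt (𝓡 m) x x)
      (v : EuclideanSpace ℝ (Fin m)) (w : EuclideanSpace ℝ (Fin m))
  D2 - diff φ x (christoffel g x v w) + christoffel h (φ x) (diff φ x v) (diff φ x w)

/-- The tension field `τ(φ) = trace ∇dφ`. -/
def tension (g : Metric m M) (h : Metric n N) (φ : M → N) (x : M) : TangentSpace (𝓡 n) (φ x) :=
  traceAt g x (secondFundamentalForm g h φ x)

/-- The `σ₂`-tension field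
`τ_{σ₂}(φ) = 2[e(φ) τ(φ) + dφ(grad e(φ))] - trace (∇dφ) ∘ C_φ - dφ(div C_φ)`, where
`trace (∇dφ) ∘ C_φ = ∑ₖ ∇dφ(eₖ, C_φ eₖ)`. -/
def sigmaTwoTension (g : Metric m M) (h : Metric n N) (φ : M → N) (x : M) :
    TangentSpace (𝓡 n) (φ x) :=
  (2 : ℝ) • (energyDensity g h φ x • tension g h φ x + diff φ x (grad g (energyDensity g h φ) x))
    - traceAt g x (fun v w => secondFundamentalForm g h φ x v (cauchyGreen g h φ x w))
    - diff φ x (divEndo g (cauchyGreen g h φ) x)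

theorem exists_eigenframe (g : Metric m M) (h : Metric n N) (φ : M → N) (x : M) :
    ∃ E : (Fin m → TangentSpace (𝓡 m) x) × (Fin m → ℝ),
      (∀ i j, g.inner x (E.1 i) (E.1 j) = if i = j then 1 else 0) ∧
      ∀ k, cauchyGreen g h φ x (E.1 k) = E.2 k • E.1 k := by
  let c := g.toRiemannianMetric.toCore x
  let _ : NormedAddCommGroup (TangentSpace (𝓡 m) x) := c.toNormedAddCommGroup
  let _ : InnerProductSpace ℝ (TangentSpace (𝓡 m) x) := InnerProductSpace.ofCore c.toCore
  have hin : ∀ v w : TangentSpace (𝓡 m) x, inner ℝ v w = g.inner x v w := fun _ _ => rfl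
  have hsym : LinearMap.IsSymmetric (cauchyGreen g h φ x).toLinearMap := by
    intro v w
    rw [hin, hin, g.symm x v]
    exact ((inner_cauchyGreen g h φ x v w).trans (h.symm _ _ _)).trans
      (inner_cauchyGreen g h φ x w v).symm
  have hfin : Module.finrank ℝ (TangentSpace (𝓡 m) x) = m :=
    finrank_euclideanSpace_fin (𝕜 := ℝ) (n := m)
  refine ⟨(fun k => hsym.eigenvectorBasis hfin k, hsym.eigenvalues hfin), ?_, ?_⟩
  · intro i j
    exact orthonormal_iff_ite.mp (hsym.eigenvectorBasis hfin).orthonormal i j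
  · intro k
    exact hsym.apply_eigenvectorBasis hfin k

/-- A `g`-orthonormal basis `E₁, …, E_m` of `T_xM` of eigenvectors of the Cauchy-Green tensor. -/
def eigenvec (g : Metric m M) (h : Metric n N) (φ : M → N) (x : M) :
    Fin m → TangentSpace (𝓡 m) x :=
  (exists_eigenframe g h φ x).choose.1

/-- The eigenvalues `λ₁², …, λ_m²` belonging to `eigenvec`. -/
def eigenval (g : Metric m M) (h : Metric n N) (φ : M → N) (x : M) : Fin m → ℝ :=
  (exists_eigenframe g h φ x).choose.2

/-- The weighted gradient `grad_{φ*h} f = ∑ₖ λₖ² Eₖ(f) Eₖ`. -/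
def weightedGrad (g : Metric m M) (h : Metric n N) (φ : M → N) (f : M → ℝ) (x : M) :
    TangentSpace (𝓡 m) x :=
  ∑ k : Fin m, (eigenval g h φ x k * dfun f x (eigenvec g h φ x k)) • eigenvec g h φ x k

/-- The vertical space `V_x = Ker dφ_x`. -/
def vertical (φ : M → N) (x : M) : Submodule ℝ (TangentSpace (𝓡 m) x) :=
  LinearMap.ker (diff (m := m) (n := n) φ x).toLinearMap

/-- The horizontal space `H_x`, the `g`-orthogonal complement of `V_x`. -/
def horizontal (g : Metric m M) (φ : M → N) (x : M) : Submodule ℝ (TangentSpace (𝓡 m) x) :=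
  ⨅ v ∈ vertical (n := n) φ x, LinearMap.ker (g.inner x v).toLinearMap

/-- The metric `g'` is the biconformal change `σ⁻² g^H + ρ⁻² g^V` of `g`, where
`g^H(X, Y) = g(X^H, Y^H)` and `g^V(X, Y) = g(X^V, Y^V)`: here the two vectors are written as the
sums of their horizontal parts `a`, `b` and their vertical parts `c`, `d`. -/
def IsBiconformalChange (g g' : Metric m M) (φ : M → N) (σ ρ : M → ℝ) : Prop :=
  ∀ x : M, ∀ a ∈ horizontal (n := n) g φ x, ∀ b ∈ horizontal (n := n) g φ x,
    ∀ c ∈ vertical (n := n) φ x, ∀ d ∈ vertical (n := n) φ x,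
      g'.inner x (a + c) (b + d) =
        (σ x ^ 2)⁻¹ * g.inner x a b + (ρ x ^ 2)⁻¹ * g.inner x c d

end Maps

end SigmaTwo

end

/-! The `σ₂`-tension field is a divergence, and a divergence depends on the source metric only
through the volume density and the flux. With `T = dφ`, let `Q = T ∘ (2e - C) ∘ G⁻¹` be the
`σ₂`-stress with its argument raised, and let `θ = d log √(det G)`. In a chart, `τ_{σ₂} = ∑ᵢ (∂ᵢ
Q(dxⁱ) + Γ^N(T ∂ᵢ, Q(dxⁱ))) + Q(θ)`, which is `(det G)^{-1/2} ∇ᵢ((det G)^{1/2} Qⁱ)`. All Christoffel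
symbols of the source are absorbed by `θ` (`formTrace_christoffelForm`,
`sigmaTwoTensionIn_eq_stressDivergence`), so the two Levi-Civita connections need never be compared.

Under the biconformal change, `T` annihilates vertical vectors, so `T G'⁻¹ = σ² T G⁻¹`. The form
`φ*h` annihilates them too, so `C' = σ² C` and `e' = σ² e`. Hence `Q' = σ⁴ Q`, whatever the rank of
`T` (`IsBiconformalForm.sigmaTwoStress_eq`).

Where `T` is surjective, the horizontal space has dimension `n` and the vertical one `m - n`, so
`det (G⁻¹ G') = σ^{-2n} ρ^{-2(m-n)}`. Both sides are continuous and such points are dense, so this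
holds everywhere (`eventually_det_eq`); only here is the almost submersion hypothesis needed.
Jacobi's formula then gives `θ' = θ + d log |σ^{-n} ρ^{n-m}|` (`logVolumeDeriv_eq_add`).

By the product rule, the divergence of `σ⁴ Q` for the new density is `σ⁴ (τ_{σ₂} + Q(dL))` with `L =
log |σ^{4-n} ρ^{n-m}|`: the 4 comes from differentiating `σ⁴`, the rest from the density. Finally
`Q(dL) = 2e dφ(grad L) - dφ(C grad L)`, and `C grad L` is the weighted gradient
(`weightedGrad_eq_cauchyGreen`). -/

noncomputable section

namespace SigmaTwo

open Filter Topology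

/-! ### Metric forms, their inverses, and Jacobi's formula -/

section Forms

variable {E F X : Type*} [NormedAddCommGroup E] [NormedSpace ℝ E]
  [NormedAddCommGroup F] [NormedSpace ℝ F] [NormedAddCommGroup X] [NormedSpace ℝ X]

/-- A symmetric positive definite bilinear form. -/
structure IsMetricForm (G : E →L[ℝ] E →L[ℝ] ℝ) : Prop where
  symm : ∀ v w, G v w = G w v
  pos : ∀ v, v ≠ 0 → 0 < G v v

theorem IsMetricForm.ext {G : E →L[ℝ] E →L[ℝ] ℝ} (hG : IsMetricForm G) {v w : E}
    (h : ∀ z, G v z = G w z) : v = w := by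
  by_contra hne
  have h1 := hG.pos (v - w) (sub_ne_zero.mpr hne)
  have h2 := h (v - w)
  rw [map_sub, hG.symm _ v, hG.symm _ w, h2, sub_self] at h1
  exact lt_irrefl _ h1

variable [FiniteDimensional ℝ E]

theorem finrank_continuousDual : Module.finrank ℝ (E →L[ℝ] ℝ) = Module.finrank ℝ E := by
  rw [← LinearEquiv.finrank_eq (LinearMap.toContinuousLinearMap (𝕜 := ℝ) (E := E) (F' := ℝ))]
  exact Subspace.dual_finrank_eq

theorem IsMetricForm.exists_equiv {G : E →L[ℝ] E →L[ℝ] ℝ} (hG : IsMetricForm G) :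
    ∃ e : E ≃L[ℝ] (E →L[ℝ] ℝ), (e : E →L[ℝ] (E →L[ℝ] ℝ)) = G := by
  have hinj : Function.Injective G.toLinearMap := fun v w h =>
    hG.ext fun z => congrArg (fun α : E →L[ℝ] ℝ => α z) h
  let e := LinearMap.linearEquivOfInjective G.toLinearMap hinj finrank_continuousDual.symm
  exact ⟨e.toContinuousLinearEquiv, by ext; rfl⟩

theorem IsMetricForm.apply_inverse {G : E →L[ℝ] E →L[ℝ] ℝ} (hG : IsMetricForm G)
    (α : E →L[ℝ] ℝ) : G (G.inverse α) = α := by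
  obtain ⟨e, rfl⟩ := hG.exists_equiv
  simp

theorem IsMetricForm.inverse_apply {G : E →L[ℝ] E →L[ℝ] ℝ} (hG : IsMetricForm G)
    (v : E) : G.inverse (G v) = v := by
  obtain ⟨e, rfl⟩ := hG.exists_equiv
  simp

theorem IsMetricForm.inverse_eq {G : E →L[ℝ] E →L[ℝ] ℝ} (hG : IsMetricForm G)
    {α : E →L[ℝ] ℝ} {v : E} (h : ∀ z, G v z = α z) : G.inverse α = v :=
  hG.ext fun z => by rw [hG.apply_inverse, h]

theorem IsMetricForm.inverse_symm {G : E →L[ℝ] E →L[ℝ] ℝ} (hG : IsMetricForm G)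
    (α β : E →L[ℝ] ℝ) : α (G.inverse β) = β (G.inverse α) := by
  have h := hG.symm (G.inverse α) (G.inverse β)
  rwa [hG.apply_inverse, hG.apply_inverse] at h

theorem IsMetricForm.contDiffAt_inverse {G : X → E →L[ℝ] E →L[ℝ] ℝ} {u : X} {k : ℕ∞ω}
    (hG : IsMetricForm (G u)) (h : ContDiffAt ℝ k G u) :
    ContDiffAt ℝ k (fun z => (G z).inverse) u := by
  obtain ⟨e, he⟩ := hG.exists_equiv
  have := FiniteDimensional.complete ℝ E
  have h1 := contDiffAt_map_inverse (𝕜 := ℝ) (n := k) e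
  rw [he] at h1
  exact h1.comp u h

theorem hasFDerivAt_inverse_form {G : X → E →L[ℝ] E →L[ℝ] ℝ}
    {G' : X →L[ℝ] E →L[ℝ] E →L[ℝ] ℝ} {u : X}
    (hG : ∀ᶠ z in 𝓝 u, IsMetricForm (G z)) (hc : ContDiffAt ℝ 1 G u) (h : HasFDerivAt G G' u) :
    ∃ S' : X →L[ℝ] (E →L[ℝ] ℝ) →L[ℝ] E, HasFDerivAt (fun z => (G z).inverse) S' u ∧
      ∀ v α, S' v α = -(G u).inverse (G' v ((G u).inverse α)) := by
  have hu := hG.self_of_nhds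
  have hS := ((hu.contDiffAt_inverse hc).differentiableAt one_ne_zero).hasFDerivAt
  refine ⟨_, hS, fun v α => ?_⟩
  set S' := fderiv ℝ (fun z => (G z).inverse) u
  -- The derivative of the inverse follows from differentiating the constant `G G⁻¹ α = α` by the
  -- product rule.
  have h1 : HasFDerivAt (fun z => G z ((G z).inverse α)) _ u :=
    h.clm_apply (hS.clm_apply (hasFDerivAt_const α u))
  have h2 : HasFDerivAt (fun z => G z ((G z).inverse α)) (0 : X →L[ℝ] (E →L[ℝ] ℝ)) u :=
    (hasFDerivAt_const α u).congr_of_eventuallyEq (by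
      filter_upwards [hG] with z hz using hz.apply_inverse α)
  have h3 := congrArg (fun L : X →L[ℝ] (E →L[ℝ] ℝ) => (G u).inverse (L v)) (h1.unique h2)
  simp [hu.inverse_apply] at h3
  exact eq_neg_of_add_eq_zero_left h3

/-- Jacobi's formula. -/
theorem hasFDerivAt_det {A : X → E →L[ℝ] E} {A' : X →L[ℝ] E →L[ℝ] E} {u : X} {B : E →L[ℝ] E}
    (h : HasFDerivAt A A' u) (hB : (A u).comp B = .id ℝ E) :
    ∃ D : X →L[ℝ] ℝ, HasFDerivAt (fun z => LinearMap.det (A z).toLinearMap) D u ∧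
      ∀ v, D v = LinearMap.det (A u).toLinearMap *
        LinearMap.trace ℝ E (B.comp (A' v)).toLinearMap := by
  -- The determinant is a polynomial in the matrix entries, so it is differentiable. Its derivative
  -- at the identity is the trace; the general case is reduced to this one by multiplying by `B`.
  classical
  let b := Module.finBasis ℝ E
  have hdiff : Differentiable ℝ (fun T : E →L[ℝ] E => LinearMap.det T.toLinearMap) := by
    have : (fun T : E →L[ℝ] E => LinearMap.det T.toLinearMap) =
        fun T => ∑ τ : Equiv.Perm (Fin (Module.finrank ℝ E)),
          ((Equiv.Perm.sign τ : ℤ) : ℝ) * ∏ i, b.coord (τ i) (T (b i)) := by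
      ext T
      rw [← LinearMap.det_toMatrix b, Matrix.det_apply']
      simp [LinearMap.toMatrix_apply]
    rw [this]
    have hc : ∀ i j, Differentiable ℝ (fun T : E →L[ℝ] E => b.coord i (T (b j))) := fun i j =>
      (LinearMap.toContinuousLinearMap (b.coord i)).differentiable.comp
        ((ContinuousLinearMap.apply ℝ E (b j)).differentiable)
    fun_prop
  have hone : ∀ M : E →L[ℝ] E, fderiv ℝ (fun T : E →L[ℝ] E => LinearMap.det T.toLinearMap)
      (.id ℝ E) M = LinearMap.trace ℝ E M.toLinearMap := by
    intro M
    have h1 : HasDerivAt (fun r : ℝ => ContinuousLinearMap.id ℝ E + r • M) M 0 := by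
      simpa using ((hasDerivAt_id (0 : ℝ)).smul_const M).const_add (.id ℝ E)
    have h0 : ContinuousLinearMap.id ℝ E + (0 : ℝ) • M = .id ℝ E := by simp
    have h2 := ((hdiff _).hasFDerivAt.comp_hasDerivAt (0 : ℝ) h1)
    rw [h0] at h2
    -- The expansion `det (1 + r M) = 1 + r tr M + r² p(r)` with `p` a polynomial: only the linear
    -- term survives at `r = 0`.
    have h3 : (fun T : E →L[ℝ] E => LinearMap.det T.toLinearMap) ∘
        (fun r : ℝ => ContinuousLinearMap.id ℝ E + r • M) =
        fun r => 1 + LinearMap.trace ℝ E M.toLinearMap * r +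
          ((1 + (Polynomial.X : Polynomial ℝ) •
            (LinearMap.toMatrix b b M.toLinearMap).map Polynomial.C).det.divX.divX).eval r
            * r ^ 2 := by
      ext r
      rw [LinearMap.trace_eq_matrix_trace ℝ b, ← Matrix.det_one_add_smul]
      simp only [Function.comp_apply]
      rw [← LinearMap.det_toMatrix b]
      congr 1
      ext i j
      simp [LinearMap.toMatrix_apply, Matrix.one_apply, Finsupp.single_apply, eq_comm]
    rw [h3] at h2
    have h4 : HasDerivAt (fun r : ℝ => 1 + LinearMap.trace ℝ E M.toLinearMap * r +
          ((1 + (Polynomial.X : Polynomial ℝ) •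
            (LinearMap.toMatrix b b M.toLinearMap).map Polynomial.C).det.divX.divX).eval r
            * r ^ 2) (LinearMap.trace ℝ E M.toLinearMap) 0 := by
      have h5 := (((hasDerivAt_id (0 : ℝ)).const_mul
        (LinearMap.trace ℝ E M.toLinearMap)).const_add 1).add
        ((Polynomial.hasDerivAt ((1 + (Polynomial.X : Polynomial ℝ) •
            (LinearMap.toMatrix b b M.toLinearMap).map Polynomial.C).det.divX.divX) 0).mul
          (hasDerivAt_pow 2 (0 : ℝ)))
      refine HasDerivAt.congr_deriv h5 ?_
      simp
    exact h2.unique h4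
  have hBA : B.comp (A u) = .id ℝ E := by
    ext v
    have := mul_eq_one_comm.mp
      (show (A u).toLinearMap * B.toLinearMap = 1 from
        congrArg ContinuousLinearMap.toLinearMap hB)
    exact LinearMap.congr_fun this v
  have h1 : HasFDerivAt (fun z => B.comp (A z)) ((ContinuousLinearMap.compL ℝ E E E B).comp A') u :=
    (ContinuousLinearMap.compL ℝ E E E B).hasFDerivAt.comp u h
  have h2 := (hdiff (B.comp (A u))).hasFDerivAt.comp u h1
  rw [hBA] at h2
  refine ⟨_, (h2.const_mul (LinearMap.det (A u).toLinearMap)).congr_of_eventuallyEq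
    (Eventually.of_forall fun z => ?_), fun v => ?_⟩
  · have hdet : LinearMap.det (A u).toLinearMap * LinearMap.det B.toLinearMap = 1 := by
      rw [← LinearMap.det_comp, ← ContinuousLinearMap.toLinearMap_comp, hB]
      exact LinearMap.det_id
    simp only [Function.comp_apply, ContinuousLinearMap.toLinearMap_comp, LinearMap.det_comp]
    rw [← mul_assoc, hdet, one_mul]
  · simp [hone]

end Forms

/-! ### Linear algebra of a biconformal change at one point -/

section Biconformal

variable {E F : Type*} [NormedAddCommGroup E] [NormedSpace ℝ E]
  [NormedAddCommGroup F] [NormedSpace ℝ F]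

/-- The form `G'` is `s⁻² G` on the `G`-orthogonal complement of `ker T` and `r⁻² G` on `ker T`. -/
def IsBiconformalForm (T : E →L[ℝ] F) (G G' : E →L[ℝ] E →L[ℝ] ℝ) (s r : ℝ) : Prop :=
  ∀ a b c d : E, (∀ v, T v = 0 → G v a = 0) → (∀ v, T v = 0 → G v b = 0) → T c = 0 → T d = 0 →
    G' (a + c) (b + d) = (s ^ 2)⁻¹ * G a b + (r ^ 2)⁻¹ * G c d

theorem exists_isCompl_ker [FiniteDimensional ℝ E] {G : E →L[ℝ] E →L[ℝ] ℝ} (hG : IsMetricForm G)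
    (T : E →L[ℝ] F) : ∃ H : Submodule ℝ E, (∀ a, a ∈ H ↔ ∀ v, T v = 0 → G v a = 0) ∧
      IsCompl H (LinearMap.ker T.toLinearMap) := by
  let B : LinearMap.BilinForm ℝ E := (ContinuousLinearMap.coeLM ℝ).comp G.toLinearMap
  have hB : ∀ v w, B v w = G v w := fun _ _ => rfl
  have hrefl : B.IsRefl := fun v w h => by rw [hB, hG.symm]; exact h
  refine ⟨B.orthogonal (LinearMap.ker T.toLinearMap), fun a => Iff.rfl, IsCompl.symm ?_⟩
  rw [LinearMap.BilinForm.isCompl_orthogonal_iff_disjoint hrefl, Submodule.disjoint_def]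
  intro v hv hv'
  by_contra hne
  exact (hG.pos v hne).ne' (hv' v hv)

variable [FiniteDimensional ℝ E] {T : E →L[ℝ] F} {G G' : E →L[ℝ] E →L[ℝ] ℝ} {s r : ℝ}

theorem exists_horizontal_add_vertical (hG : IsMetricForm G) (T : E →L[ℝ] F) (v : E) :
    ∃ a c, (∀ v, T v = 0 → G v a = 0) ∧ T c = 0 ∧ a + c = v := by
  obtain ⟨H, hH, hc⟩ := exists_isCompl_ker hG T
  obtain ⟨a, ha, c, hc, h⟩ := Submodule.mem_sup.mp
    (show v ∈ H ⊔ LinearMap.ker T.toLinearMap by rw [hc.sup_eq_top]; trivial)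
  exact ⟨a, c, (hH a).mp ha, hc, h⟩

theorem IsBiconformalForm.inverse_add (h : IsBiconformalForm T G G' s r)
    (hG : IsMetricForm G) (hG' : IsMetricForm G') (hs : s ≠ 0) (hr : r ≠ 0) {a c : E}
    (ha : ∀ v, T v = 0 → G v a = 0) (hc : T c = 0) :
    G'.inverse (G (a + c)) = s ^ 2 • a + r ^ 2 • c := by
  refine hG'.inverse_eq fun z => ?_
  obtain ⟨b, d, hb, hd, rfl⟩ := exists_horizontal_add_vertical hG T z
  rw [h _ b _ d (fun v hv => by simp [ha v hv]) hb (by simp [hc]) hd]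
  have h1 : G a d = 0 := by rw [hG.symm]; exact ha d hd
  have h2 : G c b = 0 := hb c hc
  simp [h1, h2, hs, hr]

/-- Raising an index scales the horizontal part by `s²` and the vertical part by `r²`, and `T`
forgets the vertical part. No rank condition enters. -/
theorem IsBiconformalForm.apply_inverse (h : IsBiconformalForm T G G' s r)
    (hG : IsMetricForm G) (hG' : IsMetricForm G') (hs : s ≠ 0) (hr : r ≠ 0) (α : E →L[ℝ] ℝ) :
    T (G'.inverse α) = s ^ 2 • T (G.inverse α) := by
  obtain ⟨a, c, ha, hc, hac⟩ := exists_horizontal_add_vertical hG T (G.inverse α)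
  have h1 := h.inverse_add hG hG' hs hr ha hc
  rw [hac, hG.apply_inverse] at h1
  rw [h1, ← hac]
  simp [hc]

/-- A covector that vanishes on `ker T` has a horizontal dual vector, so only the factor `s²`
appears. -/
theorem IsBiconformalForm.inverse_of_ker (h : IsBiconformalForm T G G' s r)
    (hG : IsMetricForm G) (hG' : IsMetricForm G') (hs : s ≠ 0) (hr : r ≠ 0) {α : E →L[ℝ] ℝ}
    (hα : ∀ v, T v = 0 → α v = 0) : G'.inverse α = s ^ 2 • G.inverse α := by
  have h1 := h.inverse_add hG hG' hs hr (a := G.inverse α) (c := 0)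
    (fun v hv => by rw [hG.symm, hG.apply_inverse, hα v hv]) (map_zero T)
  simpa [hG.apply_inverse] using h1

/-- `G⁻¹ G'` is `s⁻²` on the horizontal space, of dimension `dim F` by surjectivity, and `r⁻²` on
the kernel. Multiplying out avoids the subtraction of dimensions. -/
theorem IsBiconformalForm.det [FiniteDimensional ℝ F] (h : IsBiconformalForm T G G' s r)
    (hG : IsMetricForm G) (hs : s ≠ 0) (hr : r ≠ 0) (hT : Function.Surjective T) :
    LinearMap.det (G.inverse.comp G').toLinearMap * (s ^ 2) ^ Module.finrank ℝ F *
      (r ^ 2) ^ Module.finrank ℝ E = (r ^ 2) ^ Module.finrank ℝ F := by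
  obtain ⟨H, hH, hcompl⟩ := exists_isCompl_ker hG T
  set K := LinearMap.ker T.toLinearMap with hK
  let e := Submodule.prodEquivOfIsCompl H K hcompl
  have hrank : Module.finrank ℝ F + Module.finrank ℝ K = Module.finrank ℝ E := by
    rw [← LinearMap.finrank_range_add_finrank_ker T.toLinearMap,
      LinearMap.range_eq_top.mpr hT, finrank_top]
  have hrank' : Module.finrank ℝ H + Module.finrank ℝ K = Module.finrank ℝ E :=
    Submodule.finrank_add_eq_of_isCompl hcompl
  have hA : (G.inverse.comp G').toLinearMap = (e : (H × K) →ₗ[ℝ] E) ∘ₗ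
      (LinearMap.prodMap ((s ^ 2)⁻¹ • LinearMap.id) ((r ^ 2)⁻¹ • LinearMap.id)) ∘ₗ
      (e.symm : E →ₗ[ℝ] (H × K)) := by
    ext v
    obtain ⟨⟨⟨a, ha⟩, ⟨c, hc⟩⟩, rfl⟩ := e.surjective v
    simp only [LinearMap.comp_apply, LinearEquiv.coe_coe, LinearEquiv.symm_apply_apply]
    refine hG.inverse_eq fun z => ?_
    obtain ⟨b, d, hb, hd, rfl⟩ := exists_horizontal_add_vertical hG T z
    have h1 : G a d = 0 := by rw [hG.symm]; exact (hH a).mp ha d hd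
    have h2 : G c b = 0 := hb c hc
    have h3 := h a b c d ((hH a).mp ha) hb hc hd
    simp [e, h1, h2] at h3 ⊢
    linarith
  rw [hA, LinearMap.det_conj, LinearMap.det_prodMap, LinearMap.det_smul, LinearMap.det_smul,
    LinearMap.det_id, LinearMap.det_id, show Module.finrank ℝ H = Module.finrank ℝ F by omega,
    ← hrank]
  have := pow_ne_zero 2 hs
  have := pow_ne_zero 2 hr
  rw [pow_add, inv_pow, inv_pow]
  field_simp

end Biconformal

/-! ### Logarithmic derivative of the volume density -/

section Volume

variable {E X : Type*} [NormedAddCommGroup E] [NormedSpace ℝ E] [FiniteDimensional ℝ E]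
  [NormedAddCommGroup X] [NormedSpace ℝ X]

/-- The form `v ↦ ½ tr (G⁻¹ dG(v))`, the derivative of `log √(det G)`. -/
def logVolumeDeriv (G : E →L[ℝ] E →L[ℝ] ℝ) (dG : X →L[ℝ] E →L[ℝ] E →L[ℝ] ℝ) : X →ₗ[ℝ] ℝ where
  toFun v := 1 / 2 * LinearMap.trace ℝ E (G.inverse.comp (dG v)).toLinearMap
  map_add' v w := by simp [mul_add]
  map_smul' c v := by simp; ring

/-- Jacobi's formula applied to `G⁻¹ G'` gives `d log det (G⁻¹ G') = tr (G'⁻¹ dG') - tr (G⁻¹ dG)`,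
which is twice the difference of the two forms. -/
theorem logVolumeDeriv_eq_add {G G' : X → E →L[ℝ] E →L[ℝ] ℝ}
    {dG dG' : X →L[ℝ] E →L[ℝ] E →L[ℝ] ℝ} {u : X}
    (hG : ∀ᶠ z in 𝓝 u, IsMetricForm (G z)) (hG' : IsMetricForm (G' u))
    (hc : ContDiffAt ℝ 1 G u) (hd : HasFDerivAt G dG u) (hd' : HasFDerivAt G' dG' u)
    {l : X → ℝ} {dl : X →L[ℝ] ℝ} (hl : HasFDerivAt l dl u)
    (h : ∀ᶠ z in 𝓝 u,
      Real.log (LinearMap.det ((G z).inverse.comp (G' z)).toLinearMap) = 2 * l z) (v : X) :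
    logVolumeDeriv (G' u) dG' v = logVolumeDeriv (G u) dG v + dl v := by
  have hu := hG.self_of_nhds
  obtain ⟨S', hS', hS'v⟩ := hasFDerivAt_inverse_form hG hc hd
  have hAB : ((G u).inverse.comp (G' u)).comp ((G' u).inverse.comp (G u)) = .id ℝ E := by
    ext w
    simp [hu.inverse_apply, hG'.apply_inverse]
  obtain ⟨D, hD, hDv⟩ := hasFDerivAt_det (hS'.clm_comp hd') hAB
  have hdet : LinearMap.det ((G u).inverse.comp (G' u)).toLinearMap ≠ 0 := by
    intro h0
    have h1 := congrArg (fun T : E →L[ℝ] E => LinearMap.det T.toLinearMap) hAB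
    simp only [ContinuousLinearMap.toLinearMap_comp, LinearMap.det_comp] at h1 h0
    rw [h0, zero_mul] at h1
    simp at h1
  have h2 := (hD.log hdet).unique ((hl.const_mul 2).congr_of_eventuallyEq h)
  have h3 := congrArg (fun L : X →L[ℝ] ℝ => L v) h2
  simp only [smul_apply, hDv, smul_eq_mul] at h3
  rw [inv_mul_cancel_left₀ hdet] at h3
  have h4 : ((G' u).inverse.comp (G u)).comp
      ((((ContinuousLinearMap.compL ℝ E (E →L[ℝ] ℝ) E (G u).inverse).comp dG') +
        ((ContinuousLinearMap.compL ℝ E (E →L[ℝ] ℝ) E).flip (G' u)).comp S') v) =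
      (G' u).inverse.comp (dG' v) -
        ((G' u).inverse.comp ((dG v).comp (G u).inverse)).comp (G' u) := by
    ext w
    simp [hS'v, hu.apply_inverse, sub_eq_add_neg]
  rw [h4] at h3
  -- Cyclicity of the trace cancels `G'` against its inverse.
  have h5 : LinearMap.trace ℝ E
      (((G' u).inverse.comp ((dG v).comp (G u).inverse)).comp (G' u)).toLinearMap =
      LinearMap.trace ℝ E ((G u).inverse.comp (dG v)).toLinearMap := by
    rw [ContinuousLinearMap.toLinearMap_comp, LinearMap.trace_comp_comm',
      ContinuousLinearMap.toLinearMap_comp (G u).inverse (dG v),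
      LinearMap.trace_comp_comm' (dG v).toLinearMap]
    congr 1
    ext α : 1
    simp [hG'.apply_inverse]
  rw [ContinuousLinearMap.toLinearMap_sub, map_sub, h5] at h3
  simp only [logVolumeDeriv, LinearMap.coe_mk, AddHom.coe_mk]
  linarith

end Volume

/-! ### Metric traces and the traced Christoffel symbols -/

section Euclidean

variable {m : ℕ} {F : Type*} [NormedAddCommGroup F] [NormedSpace ℝ F]

theorem sum_proj_smul_single (v : EuclideanSpace ℝ (Fin m)) :
    ∑ i, v i • EuclideanSpace.single i (1 : ℝ) = v := by
  simpa using (EuclideanSpace.basisFun (Fin m) ℝ).sum_repr v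

theorem trace_eq_sum_proj (T : EuclideanSpace ℝ (Fin m) →ₗ[ℝ] EuclideanSpace ℝ (Fin m)) :
    LinearMap.trace ℝ _ T = ∑ i, T (EuclideanSpace.single i 1) i := by
  rw [LinearMap.trace_eq_sum_inner T (EuclideanSpace.basisFun (Fin m) ℝ)]
  simp [EuclideanSpace.inner_single_left]

/-- The trace of a bilinear map with respect to a metric form on Euclidean space. -/
def formTrace {W : Type*} [AddCommMonoid W]
    (G : EuclideanSpace ℝ (Fin m) →L[ℝ] EuclideanSpace ℝ (Fin m) →L[ℝ] ℝ)
    (K : EuclideanSpace ℝ (Fin m) → EuclideanSpace ℝ (Fin m) → W) : W :=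
  ∑ i, K (EuclideanSpace.single i 1) (G.inverse (EuclideanSpace.proj i))

variable {G : EuclideanSpace ℝ (Fin m) →L[ℝ] EuclideanSpace ℝ (Fin m) →L[ℝ] ℝ}

/-- The inverse matrix `gⁱʲ` is symmetric, whether or not `K` is. -/
theorem IsMetricForm.formTrace_comm {W : Type*} [NormedAddCommGroup W] [NormedSpace ℝ W]
    (hG : IsMetricForm G)
    (K : EuclideanSpace ℝ (Fin m) →L[ℝ] EuclideanSpace ℝ (Fin m) →L[ℝ] W) :
    formTrace G (fun v w => K w v) = formTrace G (fun v w => K v w) := by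
  have h1 : ∀ i, G.inverse (EuclideanSpace.proj i) =
      ∑ j, G.inverse (EuclideanSpace.proj i) j • EuclideanSpace.single j (1 : ℝ) :=
    fun i => (sum_proj_smul_single _).symm
  have h2 : ∀ i j, G.inverse (EuclideanSpace.proj i) j = G.inverse (EuclideanSpace.proj j) i :=
    fun i j => hG.inverse_symm (EuclideanSpace.proj j) (EuclideanSpace.proj i)
  unfold formTrace
  calc ∑ i, K (G.inverse (EuclideanSpace.proj i)) (EuclideanSpace.single i 1)
      = ∑ i, ∑ j, G.inverse (EuclideanSpace.proj i) j •
          K (EuclideanSpace.single j 1) (EuclideanSpace.single i 1) := by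
        refine Finset.sum_congr rfl fun i _ => ?_
        conv_lhs => rw [h1 i]
        simp
    _ = ∑ j, ∑ i, G.inverse (EuclideanSpace.proj j) i •
          K (EuclideanSpace.single j 1) (EuclideanSpace.single i 1) := by
        rw [Finset.sum_comm]
        simp_rw [h2]
    _ = ∑ j, K (EuclideanSpace.single j 1) (G.inverse (EuclideanSpace.proj j)) := by
        refine Finset.sum_congr rfl fun i _ => ?_
        conv_rhs => rw [h1 i]
        simp

theorem IsMetricForm.formTrace_eq_trace (hG : IsMetricForm G)
    (K : EuclideanSpace ℝ (Fin m) →L[ℝ] EuclideanSpace ℝ (Fin m) →L[ℝ] ℝ) :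
    formTrace G (fun v w => K v w) = LinearMap.trace ℝ _ (G.inverse.comp K).toLinearMap := by
  rw [trace_eq_sum_proj]
  exact Finset.sum_congr rfl fun i _ => hG.inverse_symm _ (EuclideanSpace.proj i)

/-- The Christoffel symbols of a metric form `G` with derivative `dG`. -/
def christoffelForm (G : EuclideanSpace ℝ (Fin m) →L[ℝ] EuclideanSpace ℝ (Fin m) →L[ℝ] ℝ)
    (dG : EuclideanSpace ℝ (Fin m) →L[ℝ] EuclideanSpace ℝ (Fin m) →L[ℝ]
      EuclideanSpace ℝ (Fin m) →L[ℝ] ℝ) (v w : EuclideanSpace ℝ (Fin m)) :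
    EuclideanSpace ℝ (Fin m) :=
  G.inverse ((1 / 2 : ℝ) • (dG v w + dG w v - (dG.flip v).flip w))

/-- After lowering the index, the first two of the three terms of `Γ` have equal traces, and the
third has trace `2θ`. The factor `½` then leaves one trace minus `θ`. -/
theorem formTrace_christoffelForm (hG : IsMetricForm G)
    (dG : EuclideanSpace ℝ (Fin m) →L[ℝ] EuclideanSpace ℝ (Fin m) →L[ℝ]
      EuclideanSpace ℝ (Fin m) →L[ℝ] ℝ) :
    formTrace G (christoffelForm G dG) =
      formTrace G (fun v w => G.inverse (dG v w)) -
        G.inverse (LinearMap.toContinuousLinearMap (logVolumeDeriv G dG)) := by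
  apply hG.ext
  intro z
  have h1 := hG.formTrace_comm dG
  have h2 : formTrace G (fun v w => dG z v w) = 2 * logVolumeDeriv G dG z := by
    rw [hG.formTrace_eq_trace]
    simp only [logVolumeDeriv, LinearMap.coe_mk, AddHom.coe_mk]
    ring
  have h3 := congrArg (fun α : EuclideanSpace ℝ (Fin m) →L[ℝ] ℝ => α z) h1
  simp only [formTrace, sum_apply] at h2 h3
  simp only [formTrace, christoffelForm, map_sum, map_sub, sum_apply, sub_apply,
    hG.apply_inverse, smul_apply, add_apply, ContinuousLinearMap.flip_apply, smul_eq_mul,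
    ← Finset.mul_sum, Finset.sum_sub_distrib, Finset.sum_add_distrib, h2, h3,
    LinearMap.coe_toContinuousLinearMap']
  ring

end Euclidean

/-! ### The tension field as a divergence of the stress -/

section SigmaTwoForm

variable {m : ℕ} {F : Type*} [NormedAddCommGroup F] [NormedSpace ℝ F]

/-- The second fundamental form of a map with first derivative `T` and second derivative `D2`, for
the metric form `G` with derivative `dG` on the source and the Christoffel symbols `N` on the
target. -/
def secondFormIn (G : EuclideanSpace ℝ (Fin m) →L[ℝ] EuclideanSpace ℝ (Fin m) →L[ℝ] ℝ)
    (dG : EuclideanSpace ℝ (Fin m) →L[ℝ] EuclideanSpace ℝ (Fin m) →L[ℝ]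
      EuclideanSpace ℝ (Fin m) →L[ℝ] ℝ)
    (T : EuclideanSpace ℝ (Fin m) →L[ℝ] F)
    (D2 : EuclideanSpace ℝ (Fin m) →L[ℝ] EuclideanSpace ℝ (Fin m) →L[ℝ] F)
    (N : F → F →ₗ[ℝ] F) (v w : EuclideanSpace ℝ (Fin m)) : F :=
  D2 v w - T (christoffelForm G dG v w) + N (T v) (T w)

/-- The expression of the `σ₂`-tension field in coordinates, in terms of the energy density `e`, the
Cauchy-Green tensor `C` and their derivatives. -/
def sigmaTwoTensionIn (G : EuclideanSpace ℝ (Fin m) →L[ℝ] EuclideanSpace ℝ (Fin m) →L[ℝ] ℝ)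
    (dG : EuclideanSpace ℝ (Fin m) →L[ℝ] EuclideanSpace ℝ (Fin m) →L[ℝ]
      EuclideanSpace ℝ (Fin m) →L[ℝ] ℝ)
    (T : EuclideanSpace ℝ (Fin m) →L[ℝ] F)
    (D2 : EuclideanSpace ℝ (Fin m) →L[ℝ] EuclideanSpace ℝ (Fin m) →L[ℝ] F)
    (N : F → F →ₗ[ℝ] F) (e : ℝ) (de : EuclideanSpace ℝ (Fin m) →L[ℝ] ℝ)
    (C : EuclideanSpace ℝ (Fin m) →L[ℝ] EuclideanSpace ℝ (Fin m))
    (dC : EuclideanSpace ℝ (Fin m) →L[ℝ] EuclideanSpace ℝ (Fin m) →L[ℝ]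
      EuclideanSpace ℝ (Fin m)) : F :=
  (2 : ℝ) • (e • formTrace G (secondFormIn G dG T D2 N) + T (G.inverse de))
    - formTrace G (fun v w => secondFormIn G dG T D2 N v (C w))
    - T (formTrace G (fun v w =>
        dC v w + christoffelForm G dG v (C w) - C (christoffelForm G dG v w)))

/-- The `σ₂`-stress `dφ ∘ (2e - C)`, with its argument raised by the metric form. -/
def sigmaTwoStress (G : EuclideanSpace ℝ (Fin m) →L[ℝ] EuclideanSpace ℝ (Fin m) →L[ℝ] ℝ)
    (T : EuclideanSpace ℝ (Fin m) →L[ℝ] F) (e : ℝ)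
    (C : EuclideanSpace ℝ (Fin m) →L[ℝ] EuclideanSpace ℝ (Fin m)) :
    (EuclideanSpace ℝ (Fin m) →L[ℝ] ℝ) →L[ℝ] F :=
  (T.comp ((2 * e) • .id ℝ _ - C)).comp G.inverse

/-- The covariant divergence of a stress `Q` with derivative `dQ`, for the density with logarithmic
derivative `θ` and the Christoffel symbols `N` of the target along `T`. -/
def stressDivergence (Q : (EuclideanSpace ℝ (Fin m) →L[ℝ] ℝ) →L[ℝ] F)
    (dQ : EuclideanSpace ℝ (Fin m) →L[ℝ] (EuclideanSpace ℝ (Fin m) →L[ℝ] ℝ) →L[ℝ] F)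
    (T : EuclideanSpace ℝ (Fin m) →L[ℝ] F) (N : F → F →ₗ[ℝ] F)
    (θ : EuclideanSpace ℝ (Fin m) →ₗ[ℝ] ℝ) : F :=
  ∑ i, (dQ (EuclideanSpace.single i 1) (EuclideanSpace.proj i)
      + N (T (EuclideanSpace.single i 1)) (Q (EuclideanSpace.proj i)))
    + Q (LinearMap.toContinuousLinearMap θ)

theorem sum_apply_single_smul_proj (α : EuclideanSpace ℝ (Fin m) →L[ℝ] ℝ) :
    ∑ i, α (EuclideanSpace.single i 1) • (EuclideanSpace.proj i :
      EuclideanSpace ℝ (Fin m) →L[ℝ] ℝ) = α := by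
  ext v
  conv_rhs => rw [← sum_proj_smul_single v]
  simp [mul_comm]

/-- Differentiating `Q = T B G⁻¹`, where `B = 2e - C`, produces the terms in `D2`, `de` and `dC`,
and `-T B G⁻¹ dG G⁻¹` from the inverse. The last, added to `Q(θ)`, is `-T B` applied to the trace of
`Γ`. On the other side, the terms `T Γ(v, C w)` from the second fundamental form and from the
divergence of `C` cancel, leaving the same expression. -/
theorem sigmaTwoTensionIn_eq_stressDivergence
    {G : EuclideanSpace ℝ (Fin m) → EuclideanSpace ℝ (Fin m) →L[ℝ] EuclideanSpace ℝ (Fin m) →L[ℝ] ℝ}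
    {dG : EuclideanSpace ℝ (Fin m) →L[ℝ] EuclideanSpace ℝ (Fin m) →L[ℝ]
      EuclideanSpace ℝ (Fin m) →L[ℝ] ℝ}
    {T : EuclideanSpace ℝ (Fin m) → EuclideanSpace ℝ (Fin m) →L[ℝ] F}
    {D2 : EuclideanSpace ℝ (Fin m) →L[ℝ] EuclideanSpace ℝ (Fin m) →L[ℝ] F}
    {e : EuclideanSpace ℝ (Fin m) → ℝ} {de : EuclideanSpace ℝ (Fin m) →L[ℝ] ℝ}
    {C : EuclideanSpace ℝ (Fin m) → EuclideanSpace ℝ (Fin m) →L[ℝ] EuclideanSpace ℝ (Fin m)}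
    {dC : EuclideanSpace ℝ (Fin m) →L[ℝ] EuclideanSpace ℝ (Fin m) →L[ℝ]
      EuclideanSpace ℝ (Fin m)}
    {u : EuclideanSpace ℝ (Fin m)} (N : F → F →ₗ[ℝ] F)
    (hG : ∀ᶠ z in 𝓝 u, IsMetricForm (G z)) (hc : ContDiffAt ℝ 1 G u) (hd : HasFDerivAt G dG u)
    (hT : HasFDerivAt T D2 u) (he : HasFDerivAt e de u) (hC : HasFDerivAt C dC u) :
    ∃ dQ, HasFDerivAt (fun z => sigmaTwoStress (G z) (T z) (e z) (C z)) dQ u ∧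
      sigmaTwoTensionIn (G u) dG (T u) D2 N (e u) de (C u) dC =
        stressDivergence (sigmaTwoStress (G u) (T u) (e u) (C u)) dQ (T u) N
          (logVolumeDeriv (G u) dG) := by
  have hu := hG.self_of_nhds
  obtain ⟨S', hS', hS'v⟩ := hasFDerivAt_inverse_form hG hc hd
  obtain ⟨dB, hB, hBv⟩ : ∃ dB : EuclideanSpace ℝ (Fin m) →L[ℝ] EuclideanSpace ℝ (Fin m) →L[ℝ]
      EuclideanSpace ℝ (Fin m),
      HasFDerivAt (fun z => (2 * e z) • ContinuousLinearMap.id ℝ _ - C z) dB u ∧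
      ∀ v w, dB v w = (2 * de v) • w - dC v w :=
    ⟨_, ((he.const_mul 2).smul_const (.id ℝ _)).sub hC, fun v w => by simp⟩
  obtain ⟨dQ, hQ, hQv⟩ : ∃ dQ : EuclideanSpace ℝ (Fin m) →L[ℝ]
      (EuclideanSpace ℝ (Fin m) →L[ℝ] ℝ) →L[ℝ] F,
      HasFDerivAt (fun z => sigmaTwoStress (G z) (T z) (e z) (C z)) dQ u ∧
      ∀ v α, dQ v α = T u
        (((2 * e u) • ContinuousLinearMap.id ℝ (EuclideanSpace ℝ (Fin m)) - C u) (S' v α)) +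
        (T u (dB v ((G u).inverse α)) +
          D2 v (((2 * e u) • ContinuousLinearMap.id ℝ (EuclideanSpace ℝ (Fin m)) - C u)
            ((G u).inverse α))) := by
    refine ⟨_, (hT.clm_comp hB).clm_comp hS', fun v α => ?_⟩
    -- With `B` opaque, the simplifier does not expand it and both sides keep the same shape.
    generalize (2 * e u) • ContinuousLinearMap.id ℝ (EuclideanSpace ℝ (Fin m)) - C u = B
    simp
  refine ⟨dQ, hQ, ?_⟩
  have hΓ := formTrace_christoffelForm hu dG
  have hde : (G u).inverse de = ∑ i, de (EuclideanSpace.single i 1) •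
      (G u).inverse (EuclideanSpace.proj i) := by
    conv_lhs => rw [← sum_apply_single_smul_proj de]
    simp
  have hθ : (G u).inverse (LinearMap.toContinuousLinearMap (logVolumeDeriv (G u) dG)) =
      ∑ i, ((G u).inverse (dG (EuclideanSpace.single i 1)
        ((G u).inverse (EuclideanSpace.proj i))) -
        christoffelForm (G u) dG (EuclideanSpace.single i 1)
          ((G u).inverse (EuclideanSpace.proj i))) := by
    rw [Finset.sum_sub_distrib]
    simp only [formTrace] at hΓ
    rw [hΓ]
    abel
  simp only [sigmaTwoTensionIn, stressDivergence, sigmaTwoStress, formTrace, secondFormIn,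
    ContinuousLinearMap.comp_apply, hθ, hde, map_sum, Finset.smul_sum, ← Finset.sum_add_distrib,
    ← Finset.sum_sub_distrib]
  refine Finset.sum_congr rfl fun i _ => ?_
  simp [hQv, hS'v, hBv]
  module

theorem hasFDerivAt_eq_smul {X V : Type*} [NormedAddCommGroup X] [NormedSpace ℝ X]
    [NormedAddCommGroup V] [NormedSpace ℝ V] {Q Q' : X → V} {dQ dQ' : X →L[ℝ] V} {u : X}
    (hQ : HasFDerivAt Q dQ u) (hQ' : HasFDerivAt Q' dQ' u) {c : X → ℝ} {dc : X →L[ℝ] ℝ}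
    (hc : HasFDerivAt c dc u) (h : ∀ᶠ z in 𝓝 u, Q' z = c z • Q z) (v : X) :
    dQ' v = c u • dQ v + dc v • Q u := by
  have h0 : Q' =ᶠ[𝓝 u] c • Q := h
  rw [hQ'.unique ((hc.smul hQ).congr_of_eventuallyEq h0)]
  rfl

/-- The product rule for `Q' = c Q`. Dividing `hdl` by `c` reads `θ' + d log c = θ + dl`, so `dl`
collects the change of density and the derivative of the factor; the target term is linear in `Q`
and simply scales. -/
theorem stressDivergence_congr
    {Q Q' : EuclideanSpace ℝ (Fin m) → (EuclideanSpace ℝ (Fin m) →L[ℝ] ℝ) →L[ℝ] F}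
    {dQ dQ' : EuclideanSpace ℝ (Fin m) →L[ℝ] (EuclideanSpace ℝ (Fin m) →L[ℝ] ℝ) →L[ℝ] F}
    {u : EuclideanSpace ℝ (Fin m)} (hQ : HasFDerivAt Q dQ u) (hQ' : HasFDerivAt Q' dQ' u)
    {c : EuclideanSpace ℝ (Fin m) → ℝ} {dc : EuclideanSpace ℝ (Fin m) →L[ℝ] ℝ}
    (hc : HasFDerivAt c dc u) (h : ∀ᶠ z in 𝓝 u, Q' z = c z • Q z)
    (T : EuclideanSpace ℝ (Fin m) →L[ℝ] F) (N : F → F →ₗ[ℝ] F)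
    {θ θ' : EuclideanSpace ℝ (Fin m) →ₗ[ℝ] ℝ} {dl : EuclideanSpace ℝ (Fin m) →L[ℝ] ℝ}
    (hdl : ∀ v, c u * θ' v + dc v = c u * (θ v + dl v)) :
    stressDivergence (Q' u) dQ' T N θ' =
      c u • (stressDivergence (Q u) dQ T N θ + Q u dl) := by
  have h2 : ∀ α : EuclideanSpace ℝ (Fin m) →L[ℝ] ℝ,
      ∑ i, α (EuclideanSpace.single i 1) • Q u (EuclideanSpace.proj i) = Q u α := by
    intro α
    conv_rhs => rw [← sum_apply_single_smul_proj α]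
    simp
  have h3 : c u • Q u (LinearMap.toContinuousLinearMap θ') + Q u dc =
      c u • (Q u (LinearMap.toContinuousLinearMap θ) + Q u dl) := by
    have h5 : c u • LinearMap.toContinuousLinearMap θ' + dc =
        c u • (LinearMap.toContinuousLinearMap θ + dl) := by
      ext v
      exact hdl v
    calc _ = Q u (c u • LinearMap.toContinuousLinearMap θ' + dc) := by
          rw [(Q u).map_add, (Q u).map_smul]
      _ = _ := by rw [h5, (Q u).map_smul, (Q u).map_add]
  have h4 := h.self_of_nhds
  have h6 : ∀ v α, dQ' v α = c u • dQ v α + dc v • Q u α := fun v α => by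
    have := hasFDerivAt_eq_smul (V := (EuclideanSpace ℝ (Fin m) →L[ℝ] ℝ) →L[ℝ] F)
      (Q := Q) (Q' := Q') hQ hQ' hc h v
    rw [this]
    rfl
  have h7 : ∀ α, Q' u α = c u • Q u α := fun α => by
    rw [h4]
    rfl
  have h8 : ∑ i, (dQ' (EuclideanSpace.single i 1) (EuclideanSpace.proj i)
      + N (T (EuclideanSpace.single i 1)) (Q' u (EuclideanSpace.proj i))) =
      c u • ∑ i, (dQ (EuclideanSpace.single i 1) (EuclideanSpace.proj i)
      + N (T (EuclideanSpace.single i 1)) (Q u (EuclideanSpace.proj i))) + Q u dc := by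
    rw [← h2 dc, Finset.smul_sum, ← Finset.sum_add_distrib]
    refine Finset.sum_congr rfl fun i _ => ?_
    rw [h6, h7, (N _).map_smul]
    module
  rw [stressDivergence, stressDivergence, h8, h7, add_assoc, smul_add, smul_add, add_assoc,
    add_right_inj, ← smul_add, ← h3, add_comm]

end SigmaTwoForm

/-! ### Metrics and functions in the preferred chart -/

section Chart

variable {m : ℕ} {M : Type*} [TopologicalSpace M] [ChartedSpace (EuclideanSpace ℝ (Fin m)) M]

theorem mfderivWithin_range_eq (x : M) (u : EuclideanSpace ℝ (Fin m)) :
    mfderivWithin 𝓘(ℝ, EuclideanSpace ℝ (Fin m)) (𝓡 m) (extChartAt (𝓡 m) x).symm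
      (range (𝓡 m)) u = chartInvDeriv x u := by
  rw [chartInvDeriv, ModelWithCorners.Boundaryless.range_eq_univ, mfderivWithin_univ]

theorem dfun_eq_of_hasFDerivAt {k : M → ℝ} {x : M} {D : EuclideanSpace ℝ (Fin m) →L[ℝ] ℝ}
    (h : HasFDerivAt (fun u => k ((extChartAt (𝓡 m) x).symm u)) D (extChartAt (𝓡 m) x x)) :
    dfun k x = D := by
  -- Manifold differentiability includes continuity on `M`; it is recovered by composing with the
  -- chart.
  have hc : ContinuousAt k x := by
    have h1 : ContinuousAt (fun y => k ((extChartAt (𝓡 m) x).symm (extChartAt (𝓡 m) x y))) x :=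
      ContinuousAt.comp (f := extChartAt (𝓡 m) x) h.continuousAt (continuousAt_extChartAt x)
    refine h1.congr ?_
    filter_upwards [extChartAt_source_mem_nhds (I := 𝓡 m) x] with y hy
    rw [(extChartAt (𝓡 m) x).left_inv hy]
  exact HasMFDerivAt.mfderiv ⟨hc, h.hasFDerivWithinAt⟩

variable [IsManifold (𝓡 m) ∞ M]

theorem chartDeriv_chartInvDeriv (x : M) {u : EuclideanSpace ℝ (Fin m)}
    (hu : u ∈ (extChartAt (𝓡 m) x).target) (v : EuclideanSpace ℝ (Fin m)) :
    chartDeriv x ((extChartAt (𝓡 m) x).symm u) (chartInvDeriv x u v) = v := by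
  have : IsManifold (𝓡 m) 1 M := .of_le (n := ∞) (by norm_cast)
  have h := mfderiv_extChartAt_comp_mfderivWithin_extChartAt_symm (I := 𝓡 m) hu
  rw [mfderivWithin_range_eq] at h
  exact congrArg (fun L : EuclideanSpace ℝ (Fin m) →L[ℝ] EuclideanSpace ℝ (Fin m) => L v) h

theorem chartInvDeriv_chartDeriv (x : M) {u : EuclideanSpace ℝ (Fin m)}
    (hu : u ∈ (extChartAt (𝓡 m) x).target)
    (v : TangentSpace (𝓡 m) ((extChartAt (𝓡 m) x).symm u)) :
    chartInvDeriv x u (chartDeriv x ((extChartAt (𝓡 m) x).symm u) v) = v := by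
  have : IsManifold (𝓡 m) 1 M := .of_le (n := ∞) (by norm_cast)
  have h := mfderivWithin_extChartAt_symm_comp_mfderiv_extChartAt (I := 𝓡 m) hu
  rw [mfderivWithin_range_eq] at h
  exact congrArg (fun L : EuclideanSpace ℝ (Fin m) →L[ℝ] EuclideanSpace ℝ (Fin m) => L v) h

theorem chartInvDeriv_self (x : M) (v : EuclideanSpace ℝ (Fin m)) :
    chartInvDeriv x (extChartAt (𝓡 m) x x) v = v := by
  have : IsManifold (𝓡 m) 1 M := .of_le (n := ∞) (by norm_cast)
  have h := mfderivWithin_range_extChartAt_symm (I := 𝓡 m) (x := x)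
  rw [mfderivWithin_range_eq] at h
  exact congrArg (fun L : EuclideanSpace ℝ (Fin m) →L[ℝ] EuclideanSpace ℝ (Fin m) => L v) h

theorem metricInChart_apply (g : Metric m M) (x : M) (u v w : EuclideanSpace ℝ (Fin m)) :
    metricInChart g x u v w = g.inner ((extChartAt (𝓡 m) x).symm u) (chartInvDeriv x u v)
      (chartInvDeriv x u w) := rfl

theorem isMetricForm_metricInChart (g : Metric m M) (x : M) {u : EuclideanSpace ℝ (Fin m)}
    (hu : u ∈ (extChartAt (𝓡 m) x).target) : IsMetricForm (metricInChart g x u) where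
  symm v w := by
    rw [metricInChart_apply, metricInChart_apply, g.symm]
  pos v hv := by
    refine g.pos _ _ fun h0 => hv ?_
    rw [← chartDeriv_chartInvDeriv x hu v]
    exact (congrArg (chartDeriv x ((extChartAt (𝓡 m) x).symm u)) h0).trans
      (chartDeriv x ((extChartAt (𝓡 m) x).symm u)).map_zero

theorem metricInChart_self (g : Metric m M) (x : M) (v w : TangentSpace (𝓡 m) x) :
    metricInChart g x (extChartAt (𝓡 m) x x) v w = g.inner x v w := by
  -- The base point equals `x` only propositionally. Forgetting the dependence of the tangent space
  -- on the point lets the equality be substituted.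
  let gi : M → EuclideanSpace ℝ (Fin m) →L[ℝ] EuclideanSpace ℝ (Fin m) →L[ℝ] ℝ :=
    fun y => g.inner y
  have h1 : ∀ (y : M) (v' w' : EuclideanSpace ℝ (Fin m)), y = x → v' = v → w' = w →
      gi y v' w' = gi x v w := by
    rintro y v' w' rfl rfl rfl
    rfl
  exact h1 _ _ _ (extChartAt_to_inv x) (chartInvDeriv_self x v) (chartInvDeriv_self x w)

theorem sharp_eq_inverse (g : Metric m M) (x : M) (α : EuclideanSpace ℝ (Fin m) →L[ℝ] ℝ) :
    sharp g x α.toLinearMap = (metricInChart g x (extChartAt (𝓡 m) x x)).inverse α := by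
  symm
  refine (isMetricForm_metricInChart g x (mem_extChartAt_target x)).inverse_eq fun z => ?_
  exact (metricInChart_self g x _ _).trans (inner_sharp g x _ z)

/-- Near `x` the tangent bundle trivialization at `x` is inverse to the chart's coordinate frame, so
the smooth section `g` in the trivialized bundle of forms is the coordinate matrix. -/
theorem contDiffAt_metricInChart (g : Metric m M) (x : M) :
    ContDiffAt ℝ ∞ (metricInChart g x) (extChartAt (𝓡 m) x x) := by
  have : IsManifold (𝓡 m) 1 M := .of_le (n := ∞) (by norm_cast)
  have h1 := (Bundle.contMDiffAt_section x).mp g.contMDiff.contMDiffAt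
  have h2 : ContMDiffAt 𝓘(ℝ, EuclideanSpace ℝ (Fin m)) (𝓡 m) ∞ (extChartAt (𝓡 m) x).symm
      (extChartAt (𝓡 m) x x) :=
    (contMDiffOn_extChartAt_symm x).contMDiffAt (extChartAt_target_mem_nhds x)
  have h3 := (ContMDiffAt.comp_of_eq h1 h2 (extChartAt_to_inv x)).contDiffAt
  refine h3.congr_of_eventuallyEq ?_
  filter_upwards [extChartAt_target_mem_nhds (I := 𝓡 m) x] with u hu
  have hs : (extChartAt (𝓡 m) x).symm u ∈ (chartAt (EuclideanSpace ℝ (Fin m)) x).source := by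
    rw [← extChartAt_source (I := 𝓡 m)]
    exact (extChartAt (𝓡 m) x).map_target hu
  have h4 := TangentBundle.symmL_trivializationAt (I := 𝓡 m) hs
  rw [(extChartAt (𝓡 m) x).right_inv hu, mfderivWithin_range_eq] at h4
  ext v w
  simp only [Function.comp_apply]
  rw [hom_trivializationAt_apply]
  rw [inCoordinates_apply_eq₂ (by simpa using hs) (by simpa using hs) (by simp)]
  rw [metricInChart_apply]
  have h5 : ∀ z, (trivializationAt (EuclideanSpace ℝ (Fin m)) (TangentSpace (𝓡 m)) x).symm
      ((extChartAt (𝓡 m) x).symm u) z = chartInvDeriv x u z := fun z =>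
    (Bundle.Trivialization.symmL_apply (R := ℝ) (trivializationAt (EuclideanSpace ℝ (Fin m))
      (TangentSpace (𝓡 m)) x) (by simpa using hs) z).symm.trans
      (congrArg (fun L : EuclideanSpace ℝ (Fin m) →L[ℝ]
        TangentSpace (𝓡 m) ((extChartAt (𝓡 m) x).symm u) => L z) h4)
  simp only [h5]
  simp

end Chart

/-! ### Endomorphisms, traces and connections in charts -/

section Chart

variable {m : ℕ} {M : Type*} [TopologicalSpace M] [ChartedSpace (EuclideanSpace ℝ (Fin m)) M]

theorem exists_mem_target {x y : M} (hy : y ∈ (extChartAt (𝓡 m) x).source) :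
    ∃ u ∈ (extChartAt (𝓡 m) x).target, (extChartAt (𝓡 m) x).symm u = y :=
  ⟨_, (extChartAt (𝓡 m) x).map_source hy, (extChartAt (𝓡 m) x).left_inv hy⟩

variable [IsManifold (𝓡 m) ∞ M]

theorem chartDeriv_injective {x y : M} (hy : y ∈ (extChartAt (𝓡 m) x).source) :
    Function.Injective (chartDeriv (m := m) x y) := by
  obtain ⟨u, hu, rfl⟩ := exists_mem_target hy
  exact Function.LeftInverse.injective (chartInvDeriv_chartDeriv x hu)

theorem chartDeriv_surjective {x y : M} (hy : y ∈ (extChartAt (𝓡 m) x).source) :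
    Function.Surjective (chartDeriv (m := m) x y) := by
  obtain ⟨u, hu, rfl⟩ := exists_mem_target hy
  exact Function.RightInverse.surjective (chartDeriv_chartInvDeriv x hu)

theorem metricInChart_chartDeriv (g : Metric m M) {x y : M}
    (hy : y ∈ (extChartAt (𝓡 m) x).source) (v w : TangentSpace (𝓡 m) y) :
    metricInChart g x (extChartAt (𝓡 m) x y) (chartDeriv x y v) (chartDeriv x y w) =
      g.inner y v w := by
  obtain ⟨u, hu, rfl⟩ := exists_mem_target hy
  rw [(extChartAt (𝓡 m) x).right_inv hu, metricInChart_apply, chartInvDeriv_chartDeriv x hu,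
    chartInvDeriv_chartDeriv x hu]

theorem metricInChart_chartDeriv_left (g : Metric m M) (x : M) {u : EuclideanSpace ℝ (Fin m)}
    (hu : u ∈ (extChartAt (𝓡 m) x).target)
    (v : TangentSpace (𝓡 m) ((extChartAt (𝓡 m) x).symm u)) (w : EuclideanSpace ℝ (Fin m)) :
    metricInChart g x u (chartDeriv x ((extChartAt (𝓡 m) x).symm u) v) w =
      g.inner ((extChartAt (𝓡 m) x).symm u) v (chartInvDeriv x u w) := by
  rw [metricInChart_apply, chartInvDeriv_chartDeriv x hu]

theorem trace_endoInChart (A : ∀ y : M, TangentSpace (𝓡 m) y →L[ℝ] TangentSpace (𝓡 m) y) (x : M)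
    {u : EuclideanSpace ℝ (Fin m)} (hu : u ∈ (extChartAt (𝓡 m) x).target) :
    LinearMap.trace ℝ _ (endoInChart A x u).toLinearMap =
      LinearMap.trace ℝ (TangentSpace (𝓡 m) ((extChartAt (𝓡 m) x).symm u))
        (A ((extChartAt (𝓡 m) x).symm u)).toLinearMap := by
  let e : EuclideanSpace ℝ (Fin m) ≃ₗ[ℝ] TangentSpace (𝓡 m) ((extChartAt (𝓡 m) x).symm u) :=
    LinearEquiv.ofLinearMap (chartInvDeriv x u).toLinearMap
      (chartDeriv x ((extChartAt (𝓡 m) x).symm u)).toLinearMap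
      (LinearMap.ext fun v => chartInvDeriv_chartDeriv x hu v)
      (LinearMap.ext fun v => chartDeriv_chartInvDeriv x hu v)
  exact LinearMap.trace_conj' (A ((extChartAt (𝓡 m) x).symm u)).toLinearMap e.symm

theorem endoInChart_self (A : ∀ y : M, TangentSpace (𝓡 m) y →L[ℝ] TangentSpace (𝓡 m) y) (x : M)
    (v : TangentSpace (𝓡 m) x) : endoInChart A x (extChartAt (𝓡 m) x x) v = A x v := by
  have : IsManifold (𝓡 m) 1 M := .of_le (n := ∞) (by norm_cast)
  let Ai : M → EuclideanSpace ℝ (Fin m) →L[ℝ] EuclideanSpace ℝ (Fin m) := A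
  let ci : M → EuclideanSpace ℝ (Fin m) →L[ℝ] EuclideanSpace ℝ (Fin m) := chartDeriv x
  have h0 : ci x = .id ℝ _ := mfderiv_extChartAt_self (I := 𝓡 m) (x := x)
  have h1 : ∀ (y : M) (v' : EuclideanSpace ℝ (Fin m)), y = x → v' = v →
      ci y (Ai y v') = Ai x v := by
    rintro y v' rfl rfl
    rw [h0]
    rfl
  exact h1 _ _ (extChartAt_to_inv x) (chartInvDeriv_self x v)

theorem christoffel_eq (g : Metric m M) (x : M) (v w : TangentSpace (𝓡 m) x) :
    christoffel g x v w = christoffelForm (metricInChart g x (extChartAt (𝓡 m) x x))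
      (fderiv ℝ (metricInChart g x) (extChartAt (𝓡 m) x x)) v w :=
  sharp_eq_inverse g x _

/-- The Christoffel symbols as a linear map in their second argument. -/
def christoffelLinear (g : Metric m M) (x : M) (v : EuclideanSpace ℝ (Fin m)) :
    EuclideanSpace ℝ (Fin m) →ₗ[ℝ] EuclideanSpace ℝ (Fin m) where
  toFun w := christoffelForm (metricInChart g x (extChartAt (𝓡 m) x x))
      (fderiv ℝ (metricInChart g x) (extChartAt (𝓡 m) x x)) v w
  map_add' w z := by
    rw [christoffelForm, christoffelForm, christoffelForm, ← map_add, ← smul_add]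
    congr 2
    simp only [map_add, add_apply]
    abel
  map_smul' c w := by
    rw [christoffelForm, christoffelForm, RingHom.id_apply, ← map_smul, smul_comm c (1 / 2 : ℝ)]
    congr 2
    simp only [map_smul, smul_apply, smul_add, smul_sub]

theorem traceAt_eq (g : Metric m M) (x : M) {W : Type*} [AddCommMonoid W]
    (B : TangentSpace (𝓡 m) x → TangentSpace (𝓡 m) x → W) :
    traceAt g x B = formTrace (metricInChart g x (extChartAt (𝓡 m) x x)) B :=
  Finset.sum_congr rfl fun i _ => congrArg (B (coordVec x i))
    (sharp_eq_inverse g x (EuclideanSpace.proj i))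

end Chart

/-! ### The map, its first fundamental form and its Cauchy-Green tensor in charts -/

section Pullback

variable {X E F : Type*} [NormedAddCommGroup E] [NormedSpace ℝ E]
  [NormedAddCommGroup F] [NormedSpace ℝ F] [NormedAddCommGroup X] [NormedSpace ℝ X]

/-- The pullback of a bilinear form by a linear map. -/
def formPullback (H : F →L[ℝ] F →L[ℝ] ℝ) (T : E →L[ℝ] F) : E →L[ℝ] E →L[ℝ] ℝ :=
  ((ContinuousLinearMap.compL ℝ E F ℝ).flip T).comp (H.comp T)

theorem contDiffAt_formPullback {H : X → F →L[ℝ] F →L[ℝ] ℝ} {T : X → E →L[ℝ] F} {u : X}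
    {k : ℕ∞ω} (hH : ContDiffAt ℝ k H u) (hT : ContDiffAt ℝ k T u) :
    ContDiffAt ℝ k (fun z => formPullback (H z) (T z)) u := by
  have h1 : ContDiffAt ℝ k (fun z => (ContinuousLinearMap.compL ℝ E F ℝ).flip (T z)) u :=
    contDiffAt_const.clm_apply hT
  exact h1.clm_comp (hH.clm_comp hT)

end Pullback

section MapChart

variable {m n : ℕ}
  {M : Type*} [TopologicalSpace M] [ChartedSpace (EuclideanSpace ℝ (Fin m)) M]
  {N : Type*} [TopologicalSpace N] [ChartedSpace (EuclideanSpace ℝ (Fin n)) N]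

/-- The map `φ` read in the preferred charts at `x` and `φ x`. -/
abbrev mapInChart (φ : M → N) (x : M) : EuclideanSpace ℝ (Fin m) → EuclideanSpace ℝ (Fin n) :=
  writtenInExtChartAt (𝓡 m) (𝓡 n) x φ

/-- The domain of `mapInChart`. -/
def mapDomain (φ : M → N) (x : M) : Set (EuclideanSpace ℝ (Fin m)) :=
  (extChartAt (𝓡 m) x).target ∩
    (extChartAt (𝓡 m) x).symm ⁻¹' (φ ⁻¹' (extChartAt (𝓡 n) (φ x)).source)

theorem isOpen_mapDomain {φ : M → N} (hφ : Continuous φ) (x : M) :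
    IsOpen (mapDomain (m := m) (n := n) φ x) :=
  (continuousOn_extChartAt_symm x).isOpen_inter_preimage (isOpen_extChartAt_target x)
    ((isOpen_extChartAt_source (φ x)).preimage hφ)

theorem mem_mapDomain (φ : M → N) (x : M) :
    extChartAt (𝓡 m) x x ∈ mapDomain (m := m) (n := n) φ x := by
  refine ⟨mem_extChartAt_target x, ?_⟩
  rw [mem_preimage, mem_preimage, extChartAt_to_inv]
  exact mem_extChartAt_source (φ x)

theorem mapDomain_mem_nhds {φ : M → N} (hφ : Continuous φ) (x : M) :
    mapDomain (m := m) (n := n) φ x ∈ 𝓝 (extChartAt (𝓡 m) x x) :=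
  (isOpen_mapDomain hφ x).mem_nhds (mem_mapDomain φ x)

theorem contDiffAt_mapInChart {φ : M → N} (hφ : ContMDiff (𝓡 m) (𝓡 n) ∞ φ) (x : M) :
    ContDiffAt ℝ ∞ (mapInChart (m := m) (n := n) φ x) (extChartAt (𝓡 m) x x) := by
  have h := (contMDiffAt_iff.mp (hφ x)).2
  rwa [ModelWithCorners.Boundaryless.range_eq_univ, contDiffWithinAt_univ] at h

/-- The first fundamental form `φ*h` read in the preferred chart at `x`. -/
def pullbackInChart [IsManifold (𝓡 n) ∞ N] (h : Metric n N) (φ : M → N) (x : M)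
    (u : EuclideanSpace ℝ (Fin m)) :
    EuclideanSpace ℝ (Fin m) →L[ℝ] EuclideanSpace ℝ (Fin m) →L[ℝ] ℝ :=
  formPullback (metricInChart h (φ x) (mapInChart φ x u)) (fderiv ℝ (mapInChart φ x) u)

theorem pullbackInChart_apply [IsManifold (𝓡 n) ∞ N] (h : Metric n N) (φ : M → N) (x : M)
    (u v w : EuclideanSpace ℝ (Fin m)) :
    pullbackInChart h φ x u v w = metricInChart h (φ x) (mapInChart φ x u)
      (fderiv ℝ (mapInChart φ x) u v) (fderiv ℝ (mapInChart φ x) u w) := rfl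

theorem contDiffAt_pullbackInChart [IsManifold (𝓡 n) ∞ N] (h : Metric n N) {φ : M → N}
    (hφ : ContMDiff (𝓡 m) (𝓡 n) ∞ φ) (x : M) :
    ContDiffAt ℝ 1 (pullbackInChart (m := m) h φ x) (extChartAt (𝓡 m) x x) := by
  have h1 := contDiffAt_mapInChart hφ x
  have h2 : ContDiffAt ℝ 1 (fderiv ℝ (mapInChart φ x)) (extChartAt (𝓡 m) x x) :=
    h1.fderiv_right (by norm_cast)
  have h3 : mapInChart φ x (extChartAt (𝓡 m) x x) = extChartAt (𝓡 n) (φ x) (φ x) := by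
    simp [mapInChart, writtenInExtChartAt]
  have h4 : ContDiffAt ℝ 1 (fun u => metricInChart h (φ x) (mapInChart φ x u))
      (extChartAt (𝓡 m) x x) := by
    have h5 := (contDiffAt_metricInChart h (φ x)).of_le (m := 1) (by norm_cast)
    rw [← h3] at h5
    exact h5.comp (extChartAt (𝓡 m) x x) (h1.of_le (m := 1) (by norm_cast))
  exact contDiffAt_formPullback h4 h2

theorem diff_eq_fderiv {φ : M → N} (hφ : ContMDiff (𝓡 m) (𝓡 n) ∞ φ) (x : M)
    (v : TangentSpace (𝓡 m) x) :
    diff (m := m) (n := n) φ x v =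
      fderiv ℝ (mapInChart (m := m) (n := n) φ x) (extChartAt (𝓡 m) x x) v := by
  let L : EuclideanSpace ℝ (Fin m) →L[ℝ] EuclideanSpace ℝ (Fin n) := diff (m := m) φ x
  have h1 : HasFDerivWithinAt (mapInChart (m := m) (n := n) φ x) L univ
      (extChartAt (𝓡 m) x x) := by
    have h2 := ((hφ x).mdifferentiableAt (by norm_num)).hasMFDerivAt.2
    rwa [ModelWithCorners.Boundaryless.range_eq_univ] at h2
  rw [(hasFDerivWithinAt_univ.mp h1).fderiv]
  rfl

variable [IsManifold (𝓡 m) ∞ M] [IsManifold (𝓡 n) ∞ N]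

theorem fderiv_mapInChart {φ : M → N} (hφ : ContMDiff (𝓡 m) (𝓡 n) ∞ φ) {x : M}
    {u : EuclideanSpace ℝ (Fin m)} (hu : u ∈ mapDomain (m := m) (n := n) φ x)
    (v : EuclideanSpace ℝ (Fin m)) :
    fderiv ℝ (mapInChart (m := m) (n := n) φ x) u v =
      chartDeriv (φ x) (φ ((extChartAt (𝓡 m) x).symm u))
        (diff φ ((extChartAt (𝓡 m) x).symm u) (chartInvDeriv x u v)) := by
  have : IsManifold (𝓡 m) 1 M := .of_le (n := ∞) (by norm_cast)
  have : IsManifold (𝓡 n) 1 N := .of_le (n := ∞) (by norm_cast)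
  have h1 : HasMFDerivAt 𝓘(ℝ, EuclideanSpace ℝ (Fin m)) (𝓡 m) (extChartAt (𝓡 m) x).symm u
      (chartInvDeriv x u) :=
    (((contMDiffOn_extChartAt_symm (n := ∞) x).contMDiffAt
      ((isOpen_extChartAt_target x).mem_nhds hu.1)).mdifferentiableAt (by norm_num)).hasMFDerivAt
  have h2 := ((hφ ((extChartAt (𝓡 m) x).symm u)).mdifferentiableAt (by norm_num)).hasMFDerivAt
  have h3 := (mdifferentiableAt_extChartAt (I := 𝓡 n) (x := φ x)
    (y := φ ((extChartAt (𝓡 m) x).symm u))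
    (by rw [← extChartAt_source (𝓡 n)]; exact hu.2)).hasMFDerivAt
  have h4 : HasMFDerivAt 𝓘(ℝ, EuclideanSpace ℝ (Fin m)) 𝓘(ℝ, EuclideanSpace ℝ (Fin n))
      (mapInChart φ x) u _ := h3.comp u (h2.comp u h1)
  have h5 := h4.mfderiv
  rw [mfderiv_eq_fderiv] at h5
  exact congrArg (fun L : EuclideanSpace ℝ (Fin m) →L[ℝ] EuclideanSpace ℝ (Fin n) => L v) h5

theorem pullbackInChart_eq (h : Metric n N) {φ : M → N} (hφ : ContMDiff (𝓡 m) (𝓡 n) ∞ φ) {x : M}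
    {u : EuclideanSpace ℝ (Fin m)} (hu : u ∈ mapDomain (m := m) (n := n) φ x)
    (v w : EuclideanSpace ℝ (Fin m)) :
    pullbackInChart h φ x u v w = pullbackForm h φ ((extChartAt (𝓡 m) x).symm u)
      (chartInvDeriv x u v) (chartInvDeriv x u w) := by
  rw [pullbackInChart_apply, fderiv_mapInChart hφ hu, fderiv_mapInChart hφ hu]
  exact metricInChart_chartDeriv h hu.2 _ _

/-- In the form `G⁻¹ (φ*h)` the source metric enters only through `G⁻¹`. This gives both the
differentiability of the tensor and its scaling. -/
theorem endoInChart_cauchyGreen (g : Metric m M) (h : Metric n N) {φ : M → N}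
    (hφ : ContMDiff (𝓡 m) (𝓡 n) ∞ φ) {x : M} {u : EuclideanSpace ℝ (Fin m)}
    (hu : u ∈ mapDomain (m := m) (n := n) φ x) :
    endoInChart (cauchyGreen g h φ) x u =
      (metricInChart g x u).inverse.comp (pullbackInChart h φ x u) := by
  ext1 v
  symm
  refine (isMetricForm_metricInChart g x hu.1).inverse_eq fun z => ?_
  exact ((metricInChart_chartDeriv_left g x hu.1 _ z).trans (inner_cauchyGreen g h φ _ _ _)).trans
    (pullbackInChart_eq h hφ hu v z).symm

theorem energyDensity_eq (g : Metric m M) (h : Metric n N) (φ : M → N) {x : M}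
    {u : EuclideanSpace ℝ (Fin m)} (hu : u ∈ (extChartAt (𝓡 m) x).target) :
    energyDensity g h φ ((extChartAt (𝓡 m) x).symm u) =
      1 / 2 * LinearMap.trace ℝ _ (endoInChart (cauchyGreen g h φ) x u).toLinearMap := by
  rw [energyDensity, trace_endoInChart _ x hu]

theorem differentiableAt_endoInChart_cauchyGreen (g : Metric m M) (h : Metric n N) {φ : M → N}
    (hφ : ContMDiff (𝓡 m) (𝓡 n) ∞ φ) (x : M) :
    DifferentiableAt ℝ (endoInChart (cauchyGreen g h φ) x) (extChartAt (𝓡 m) x x) := by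
  have h1 := (isMetricForm_metricInChart g x (mem_extChartAt_target x)).contDiffAt_inverse
    ((contDiffAt_metricInChart g x).of_le (m := 1) (by norm_cast))
  refine ((h1.clm_comp (contDiffAt_pullbackInChart h hφ x)).differentiableAt
    one_ne_zero).congr_of_eventuallyEq ?_
  filter_upwards [mapDomain_mem_nhds (m := m) (n := n) hφ.continuous x] with u hu
  exact endoInChart_cauchyGreen g h hφ hu

theorem differentiableAt_energyDensity (g : Metric m M) (h : Metric n N) {φ : M → N}
    (hφ : ContMDiff (𝓡 m) (𝓡 n) ∞ φ) (x : M) :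
    DifferentiableAt ℝ (fun u => energyDensity g h φ ((extChartAt (𝓡 m) x).symm u))
      (extChartAt (𝓡 m) x x) := by
  let tr : (EuclideanSpace ℝ (Fin m) →L[ℝ] EuclideanSpace ℝ (Fin m)) →L[ℝ] ℝ :=
    LinearMap.toContinuousLinearMap
      ((LinearMap.trace ℝ (EuclideanSpace ℝ (Fin m))).comp (ContinuousLinearMap.coeLM ℝ))
  have h1 := (tr.differentiableAt.comp _
    (differentiableAt_endoInChart_cauchyGreen g h hφ x)).const_mul (1 / 2 : ℝ)
  refine h1.congr_of_eventuallyEq ?_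
  filter_upwards [extChartAt_target_mem_nhds (I := 𝓡 m) x] with u hu
  exact energyDensity_eq g h φ hu

end MapChart

/-! ### Orthonormal expansion -/

section Orthonormal

theorem sum_inner_smul_of_orthonormal {m : ℕ} {E : Type*} [NormedAddCommGroup E]
    [NormedSpace ℝ E] [FiniteDimensional ℝ E] (hE : Module.finrank ℝ E = m)
    (G : E →L[ℝ] E →L[ℝ] ℝ) {b : Fin m → E} (hb : ∀ i j, G (b i) (b j) = if i = j then 1 else 0)
    (w : E) : ∑ k, G w (b k) • b k = w := by
  have hcoef : ∀ (c : Fin m → ℝ) j, G (∑ i, c i • b i) (b j) = c j := by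
    intro c j
    simp [hb]
  have hli : LinearIndependent ℝ b := by
    rw [Fintype.linearIndependent_iff]
    intro c hc j
    rw [← hcoef c j, hc, map_zero, zero_apply]
  have hspan := hli.span_eq_top_of_card_eq_finrank' (by simp [hE])
  obtain ⟨c, rfl⟩ := (Submodule.mem_span_range_iff_exists_fun ℝ).mp
    (show w ∈ Submodule.span ℝ (range b) by rw [hspan]; trivial)
  simp only [hcoef]

end Orthonormal

/-! ### From the manifold to coordinates -/

section Transfer

variable {m n : ℕ}
  {M : Type*} [TopologicalSpace M] [ChartedSpace (EuclideanSpace ℝ (Fin m)) M]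
  {N : Type*} [TopologicalSpace N] [ChartedSpace (EuclideanSpace ℝ (Fin n)) N]
  [IsManifold (𝓡 m) ∞ M] [IsManifold (𝓡 n) ∞ N]

/-- The gradient has coefficients `df(Eₖ)` in the eigenbasis, on which the tensor acts by `λₖ²`. In
particular the choice of eigenframe is immaterial. -/
theorem weightedGrad_eq_cauchyGreen (g : Metric m M) (h : Metric n N) (φ : M → N) (f : M → ℝ)
    (x : M) : weightedGrad g h φ f x = cauchyGreen g h φ x (grad g f x) := by
  have hE := (exists_eigenframe g h φ x).choose_spec
  have h1 : ∑ k, g.inner x (grad g f x) (eigenvec g h φ x k) • eigenvec g h φ x k =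
      grad g f x :=
    sum_inner_smul_of_orthonormal (E := EuclideanSpace ℝ (Fin m)) (by simp) (g.inner x) hE.1 _
  rw [← h1, map_sum, weightedGrad]
  refine Finset.sum_congr rfl fun k _ => ?_
  have h2 : cauchyGreen g h φ x (eigenvec g h φ x k) =
    eigenval g h φ x k • eigenvec g h φ x k := hE.2 k
  have h3 : g.inner x (grad g f x) (eigenvec g h φ x k) = dfun f x (eigenvec g h φ x k) :=
    inner_sharp g x _ _
  rw [map_smul, h2, h3, smul_smul, mul_comm]

theorem sigmaTwoTension_eq (g : Metric m M) (h : Metric n N) {φ : M → N}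
    (hφ : ContMDiff (𝓡 m) (𝓡 n) ∞ φ) (x : M) :
    sigmaTwoTension g h φ x =
      sigmaTwoTensionIn (metricInChart g x (extChartAt (𝓡 m) x x))
        (fderiv ℝ (metricInChart g x) (extChartAt (𝓡 m) x x))
        (fderiv ℝ (mapInChart φ x) (extChartAt (𝓡 m) x x))
        (fderiv ℝ (fderiv ℝ (mapInChart φ x)) (extChartAt (𝓡 m) x x))
        (christoffelLinear h (φ x))
        (energyDensity g h φ x) (dfun (energyDensity g h φ) x)
        (endoInChart (cauchyGreen g h φ) x (extChartAt (𝓡 m) x x))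
        (fderiv ℝ (endoInChart (cauchyGreen g h φ) x) (extChartAt (𝓡 m) x x)) := by
  -- Each ingredient is renamed with Euclidean types, definitionally equal to the tangent spaces, so
  -- that it can be rewritten without dependent types.
  let D : EuclideanSpace ℝ (Fin m) →L[ℝ] EuclideanSpace ℝ (Fin n) := diff φ x
  have hD : D = fderiv ℝ (mapInChart φ x) (extChartAt (𝓡 m) x x) :=
    ContinuousLinearMap.ext (diff_eq_fderiv hφ x)
  let C : EuclideanSpace ℝ (Fin m) →L[ℝ] EuclideanSpace ℝ (Fin m) := cauchyGreen g h φ x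
  have hC : C = endoInChart (cauchyGreen g h φ) x (extChartAt (𝓡 m) x x) :=
    ContinuousLinearMap.ext fun v => (endoInChart_self _ x v).symm
  let Γ : EuclideanSpace ℝ (Fin m) → EuclideanSpace ℝ (Fin m) → EuclideanSpace ℝ (Fin m) :=
    christoffel g x
  have hΓ : Γ = christoffelForm (metricInChart g x (extChartAt (𝓡 m) x x))
      (fderiv ℝ (metricInChart g x) (extChartAt (𝓡 m) x x)) :=
    funext fun v => funext fun w => christoffel_eq g x v w
  let Γ' : EuclideanSpace ℝ (Fin n) → EuclideanSpace ℝ (Fin n) → EuclideanSpace ℝ (Fin n) :=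
    christoffel h (φ x)
  have hΓ' : Γ' = fun v w => christoffelLinear h (φ x) v w :=
    funext fun v => funext fun w => christoffel_eq h (φ x) v w
  let II : EuclideanSpace ℝ (Fin m) → EuclideanSpace ℝ (Fin m) → EuclideanSpace ℝ (Fin n) :=
    secondFundamentalForm g h φ x
  have hII : II = fun v w =>
      fderiv ℝ (fderiv ℝ (mapInChart φ x)) (extChartAt (𝓡 m) x x) v w - D (Γ v w) +
        Γ' (D v) (D w) := rfl
  let K : EuclideanSpace ℝ (Fin m) → EuclideanSpace ℝ (Fin m) → EuclideanSpace ℝ (Fin m) :=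
    covDerivEndo g (cauchyGreen g h φ) x
  have hK : K = fun v w =>
      fderiv ℝ (endoInChart (cauchyGreen g h φ) x) (extChartAt (𝓡 m) x x) v w + Γ v (C w) -
        C (Γ v w) := rfl
  have hgrad : grad g (energyDensity g h φ) x =
      (metricInChart g x (extChartAt (𝓡 m) x x)).inverse (dfun (energyDensity g h φ) x) :=
    sharp_eq_inverse g x _
  have hmain : sigmaTwoTension g h φ x = (2 : ℝ) •
      (energyDensity g h φ x • formTrace (metricInChart g x (extChartAt (𝓡 m) x x)) II +
        D ((metricInChart g x (extChartAt (𝓡 m) x x)).inverse (dfun (energyDensity g h φ) x)))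
      - formTrace (metricInChart g x (extChartAt (𝓡 m) x x)) (fun v w => II v (C w))
      - D (formTrace (metricInChart g x (extChartAt (𝓡 m) x x)) K) := by
    rw [sigmaTwoTension, tension, divEndo, traceAt_eq, traceAt_eq, traceAt_eq, hgrad]
    rfl
  rw [hmain, hII, hK, hΓ', hΓ, hD, hC]
  rfl

theorem isBiconformalForm_metricInChart {g g' : Metric m M} {φ : M → N}
    (hφ : ContMDiff (𝓡 m) (𝓡 n) ∞ φ) {σ ρ : M → ℝ}
    (h : IsBiconformalChange (n := n) g g' φ σ ρ) {x : M}
    {u : EuclideanSpace ℝ (Fin m)} (hu : u ∈ mapDomain (m := m) (n := n) φ x) :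
    IsBiconformalForm (fderiv ℝ (mapInChart (m := m) (n := n) φ x) u) (metricInChart g x u)
      (metricInChart g' x u) (σ ((extChartAt (𝓡 m) x).symm u))
      (ρ ((extChartAt (𝓡 m) x).symm u)) := by
  have hv : ∀ c, fderiv ℝ (mapInChart (m := m) (n := n) φ x) u c = 0 →
      chartInvDeriv x u c ∈ vertical (n := n) φ ((extChartAt (𝓡 m) x).symm u) := by
    intro c hc
    rw [fderiv_mapInChart hφ hu] at hc
    exact chartDeriv_injective hu.2 (hc.trans (map_zero _).symm)
  have hh : ∀ a, (∀ v, fderiv ℝ (mapInChart (m := m) (n := n) φ x) u v = 0 →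
      metricInChart g x u v a = 0) →
      chartInvDeriv x u a ∈ horizontal (n := n) g φ ((extChartAt (𝓡 m) x).symm u) := by
    intro a ha
    simp only [horizontal, Submodule.mem_iInf]
    intro v hv
    have h1 := ha (chartDeriv x _ v) (by
      rw [fderiv_mapInChart hφ hu, chartInvDeriv_chartDeriv x hu.1]
      exact (congrArg (chartDeriv (φ x) _) hv).trans (map_zero _))
    rw [metricInChart_chartDeriv_left g x hu.1] at h1
    exact h1
  intro a b c d ha hb hc hd
  have h1 := h _ _ (hh a ha) _ (hh b hb) _ (hv c hc) _ (hv d hd)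
  rw [metricInChart_apply, (chartInvDeriv x u).map_add, (chartInvDeriv x u).map_add]
  exact h1

theorem surjective_fderiv_mapInChart {φ : M → N} (hφ : ContMDiff (𝓡 m) (𝓡 n) ∞ φ) {x : M}
    {u : EuclideanSpace ℝ (Fin m)} (hu : u ∈ mapDomain (m := m) (n := n) φ x)
    (h : Function.Surjective (diff (m := m) (n := n) φ ((extChartAt (𝓡 m) x).symm u))) :
    Function.Surjective (fderiv ℝ (mapInChart (m := m) (n := n) φ x) u) := by
  intro w
  obtain ⟨w', rfl⟩ := chartDeriv_surjective hu.2 w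
  obtain ⟨v, rfl⟩ := h w'
  refine ⟨chartDeriv x _ v, ?_⟩
  rw [fderiv_mapInChart hφ hu, chartInvDeriv_chartDeriv x hu.1]

theorem IsAlmostSubmersion.mem_closure {φ : M → N} (hφ : ContMDiff (𝓡 m) (𝓡 n) ∞ φ)
    (hsub : IsAlmostSubmersion (m := m) (n := n) φ) {x : M} {u : EuclideanSpace ℝ (Fin m)}
    (hu : u ∈ mapDomain (m := m) (n := n) φ x) :
    u ∈ closure {z ∈ mapDomain (m := m) (n := n) φ x |
      Function.Surjective (fderiv ℝ (mapInChart (m := m) (n := n) φ x) z)} := by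
  rw [_root_.mem_closure_iff]
  intro o ho huo
  have h1 : IsOpen ((extChartAt (𝓡 m) x).source ∩ extChartAt (𝓡 m) x ⁻¹'
      (o ∩ mapDomain (m := m) (n := n) φ x)) :=
    (continuousOn_extChartAt x).isOpen_inter_preimage (isOpen_extChartAt_source x)
      (ho.inter (isOpen_mapDomain hφ.continuous x))
  obtain ⟨y, hys, hy, hyo, hyd⟩ := hsub.exists_mem_open h1
    ⟨(extChartAt (𝓡 m) x).symm u, (extChartAt (𝓡 m) x).map_target hu.1, by
      rw [mem_preimage, (extChartAt (𝓡 m) x).right_inv hu.1]; exact ⟨huo, hu⟩⟩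
  obtain ⟨z, hz, rfl⟩ := exists_mem_target hy
  rw [(extChartAt (𝓡 m) x).right_inv hz] at hyo hyd
  exact ⟨z, hyo, hyd, surjective_fderiv_mapInChart hφ hyd hys⟩

end Transfer

/-! ### Scaling of the stress -/

section Comparison

variable {m : ℕ} {F : Type*} [NormedAddCommGroup F] [NormedSpace ℝ F]

theorem formPullback_apply {E : Type*} [NormedAddCommGroup E] [NormedSpace ℝ E]
    (H : F →L[ℝ] F →L[ℝ] ℝ) (T : E →L[ℝ] F) (v w : E) :
    formPullback H T v w = H (T v) (T w) := rfl

theorem IsBiconformalForm.inverse_comp_formPullback {E : Type*} [NormedAddCommGroup E]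
    [NormedSpace ℝ E] [FiniteDimensional ℝ E] {T : E →L[ℝ] F} {G G' : E →L[ℝ] E →L[ℝ] ℝ}
    {s r : ℝ} (h : IsBiconformalForm T G G' s r)
    (hG : IsMetricForm G) (hG' : IsMetricForm G') (hs : s ≠ 0) (hr : r ≠ 0)
    (H : F →L[ℝ] F →L[ℝ] ℝ) :
    G'.inverse.comp (formPullback H T) = s ^ 2 • G.inverse.comp (formPullback H T) := by
  ext1 v
  exact h.inverse_of_ker hG hG' hs hr fun w hw => by
    exact (congrArg (H (T v)) hw).trans (map_zero _)

/-- One factor `s²` comes from `T G⁻¹` and another from `2e - C`. In the term with `C`, `φ*h` sees a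
vector only through `T`, which provides the second factor. -/
theorem IsBiconformalForm.sigmaTwoStress_eq
    {T : EuclideanSpace ℝ (Fin m) →L[ℝ] F}
    {G G' : EuclideanSpace ℝ (Fin m) →L[ℝ] EuclideanSpace ℝ (Fin m) →L[ℝ] ℝ} {s r : ℝ}
    (h : IsBiconformalForm T G G' s r)
    (hG : IsMetricForm G) (hG' : IsMetricForm G') (hs : s ≠ 0) (hr : r ≠ 0)
    (H : F →L[ℝ] F →L[ℝ] ℝ) (e : ℝ) :
    sigmaTwoStress G' T (s ^ 2 * e) (G'.inverse.comp (formPullback H T)) =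
      s ^ 4 • sigmaTwoStress G T e (G.inverse.comp (formPullback H T)) := by
  rw [h.inverse_comp_formPullback hG hG' hs hr]
  ext1 α
  have h1 := h.apply_inverse hG hG' hs hr α
  have h2 : formPullback H T (G'.inverse α) = s ^ 2 • formPullback H T (G.inverse α) := by
    ext w
    simp [formPullback_apply, h1]
  simp only [sigmaTwoStress, ContinuousLinearMap.comp_apply, sub_apply, smul_apply,
    ContinuousLinearMap.id_apply, map_sub, map_smul, h1, h2]
  module

end Comparison

/-! ### Density argument and the transformation law -/

section Main

variable {m n : ℕ}
  {M : Type*} [TopologicalSpace M] [ChartedSpace (EuclideanSpace ℝ (Fin m)) M]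
  {N : Type*} [TopologicalSpace N] [ChartedSpace (EuclideanSpace ℝ (Fin n)) N]
  [IsManifold (𝓡 m) ∞ M] [IsManifold (𝓡 n) ∞ N]
  {g g' : Metric m M} {φ : M → N} {σ ρ : M → ℝ}

theorem eventually_isMetricForm_metricInChart (g : Metric m M) (x : M) :
    ∀ᶠ u in 𝓝 (extChartAt (𝓡 m) x x), IsMetricForm (metricInChart g x u) := by
  filter_upwards [extChartAt_target_mem_nhds (I := 𝓡 m) x] with u hu
  exact isMetricForm_metricInChart g x hu

theorem contDiffAt_comp_chart {f : M → ℝ} (hf : ContMDiff (𝓡 m) 𝓘(ℝ, ℝ) ∞ f) {x : M}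
    {u : EuclideanSpace ℝ (Fin m)} (hu : u ∈ (extChartAt (𝓡 m) x).target) :
    ContDiffAt ℝ ∞ (fun u => f ((extChartAt (𝓡 m) x).symm u)) u :=
  (ContMDiffAt.comp u hf.contMDiffAt ((contMDiffOn_extChartAt_symm x).contMDiffAt
    ((isOpen_extChartAt_target x).mem_nhds hu))).contDiffAt

/-- The rank count is available only at submersive points, but both sides are continuous and these
points are dense. The identity is needed on a whole neighbourhood because it is differentiated
later. -/
theorem eventually_det_eq (hφ : ContMDiff (𝓡 m) (𝓡 n) ∞ φ)
    (hsub : IsAlmostSubmersion (m := m) (n := n) φ)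
    (hσ : ContMDiff (𝓡 m) 𝓘(ℝ, ℝ) ∞ σ) (hσ0 : ∀ x, σ x ≠ 0)
    (hρ : ContMDiff (𝓡 m) 𝓘(ℝ, ℝ) ∞ ρ) (hρ0 : ∀ x, ρ x ≠ 0)
    (h : IsBiconformalChange (n := n) g g' φ σ ρ) (x : M) :
    ∀ᶠ u in 𝓝 (extChartAt (𝓡 m) x x),
      LinearMap.det ((metricInChart g x u).inverse.comp (metricInChart g' x u)).toLinearMap *
        (σ ((extChartAt (𝓡 m) x).symm u) ^ 2) ^ n * (ρ ((extChartAt (𝓡 m) x).symm u) ^ 2) ^ m =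
      (ρ ((extChartAt (𝓡 m) x).symm u) ^ 2) ^ n := by
  have hc : ∀ᶠ u in 𝓝 (extChartAt (𝓡 m) x x), ContDiffAt ℝ 1 (metricInChart g x) u :=
    ((contDiffAt_metricInChart g x).of_le (m := 1) (by norm_cast)).eventually (by simp)
  have hc' : ∀ᶠ u in 𝓝 (extChartAt (𝓡 m) x x), ContDiffAt ℝ 1 (metricInChart g' x) u :=
    ((contDiffAt_metricInChart g' x).of_le (m := 1) (by norm_cast)).eventually (by simp)
  filter_upwards [mapDomain_mem_nhds (m := m) (n := n) hφ.continuous x, hc, hc'] with u hu hu1 hu2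
  have hi := (isMetricForm_metricInChart g x hu.1).contDiffAt_inverse hu1
  have hdet : ContinuousAt (fun u => LinearMap.det
      ((metricInChart g x u).inverse.comp (metricInChart g' x u)).toLinearMap) u :=
    ContinuousLinearMap.continuous_det.continuousAt.comp (hi.clm_comp hu2).continuousAt
  have hσc := (contDiffAt_comp_chart hσ hu.1).continuousAt
  have hρc := (contDiffAt_comp_chart hρ hu.1).continuousAt
  have hl := (hdet.mul ((hσc.pow 2).pow n)).mul ((hρc.pow 2).pow m)
  have hr := (hρc.pow 2).pow n
  -- If the identity failed at `u`, it would fail on a neighbourhood, which contains a submersive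
  -- point.
  by_contra hne
  have h1 := (hl.ne_iff_eventually_ne hr).mp hne
  obtain ⟨z, ⟨hz, hzs⟩, hz1⟩ :=
    ((mem_closure_iff_frequently.mp (hsub.mem_closure hφ hu)).and_eventually h1).exists
  have h2 := (isBiconformalForm_metricInChart hφ h hz).det
    (isMetricForm_metricInChart g x hz.1) (hσ0 _) (hρ0 _) hzs
  rw [finrank_euclideanSpace_fin, finrank_euclideanSpace_fin] at h2
  exact hz1 h2

theorem sigmaTwoTension_biconformal (hφ : ContMDiff (𝓡 m) (𝓡 n) ∞ φ)
    (hsub : IsAlmostSubmersion (m := m) (n := n) φ)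
    (hσ : ContMDiff (𝓡 m) 𝓘(ℝ, ℝ) ∞ σ) (hσ0 : ∀ x, σ x ≠ 0)
    (hρ : ContMDiff (𝓡 m) 𝓘(ℝ, ℝ) ∞ ρ) (hρ0 : ∀ x, ρ x ≠ 0)
    (hb : IsBiconformalChange (n := n) g g' φ σ ρ) (h : Metric n N) (x : M) :
    sigmaTwoTension g' h φ x = σ x ^ 4 • (sigmaTwoTension g h φ x
      + (2 * energyDensity g h φ x) • diff φ x (grad g
          (fun y => Real.log |σ y ^ (4 - (n : ℤ)) * ρ y ^ ((n : ℤ) - (m : ℤ))|) x)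
      - diff φ x (weightedGrad g h φ
          (fun y => Real.log |σ y ^ (4 - (n : ℤ)) * ρ y ^ ((n : ℤ) - (m : ℤ))|) x)) := by
  set L : M → ℝ := fun y => Real.log |σ y ^ (4 - (n : ℤ)) * ρ y ^ ((n : ℤ) - (m : ℤ))| with hL
  let s : EuclideanSpace ℝ (Fin m) → ℝ := fun u => σ ((extChartAt (𝓡 m) x).symm u)
  let r : EuclideanSpace ℝ (Fin m) → ℝ := fun u => ρ ((extChartAt (𝓡 m) x).symm u)
  have hs0 : ∀ u, s u ≠ 0 := fun u => hσ0 _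
  have hr0 : ∀ u, r u ≠ 0 := fun u => hρ0 _
  have hsd : HasFDerivAt s (fderiv ℝ s (extChartAt (𝓡 m) x x)) (extChartAt (𝓡 m) x x) :=
    ((contDiffAt_comp_chart hσ (mem_extChartAt_target x)).differentiableAt
      (by norm_num)).hasFDerivAt
  have hrd : HasFDerivAt r (fderiv ℝ r (extChartAt (𝓡 m) x x)) (extChartAt (𝓡 m) x x) :=
    ((contDiffAt_comp_chart hρ (mem_extChartAt_target x)).differentiableAt
      (by norm_num)).hasFDerivAt
  -- The logarithm of the density ratio, `log |ρ^{n-m} σ^{-n}|`. Real logarithms ignore signs, so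
  -- `σ` and `ρ` need not be positive.
  obtain ⟨dl, hld⟩ : ∃ dl : EuclideanSpace ℝ (Fin m) →L[ℝ] ℝ,
      HasFDerivAt (fun u => ((n : ℝ) - m) * Real.log (r u) - n * Real.log (s u)) dl
        (extChartAt (𝓡 m) x x) :=
    ⟨_, ((hrd.log (hr0 (extChartAt (𝓡 m) x x))).const_mul ((n : ℝ) - m)).sub
      ((hsd.log (hs0 (extChartAt (𝓡 m) x x))).const_mul (n : ℝ))⟩
  have hLs : ∀ u, L ((extChartAt (𝓡 m) x).symm u) =
      4 * Real.log (s u) + (((n : ℝ) - m) * Real.log (r u) - n * Real.log (s u)) := by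
    intro u
    simp only [hL, Real.log_abs]
    rw [Real.log_mul (zpow_ne_zero _ (hσ0 _)) (zpow_ne_zero _ (hρ0 _)), Real.log_zpow,
      Real.log_zpow]
    push_cast
    ring
  obtain ⟨dL, hdL, hdLv⟩ : ∃ dL : EuclideanSpace ℝ (Fin m) →L[ℝ] ℝ, dfun L x = dL ∧
      ∀ v, dL v = 4 * ((s (extChartAt (𝓡 m) x x))⁻¹ * fderiv ℝ s (extChartAt (𝓡 m) x x) v) + dl v :=
    ⟨_, dfun_eq_of_hasFDerivAt (k := L) ((((hsd.log (hs0 (extChartAt (𝓡 m) x x))).const_mul 4).add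
      hld).congr_of_eventuallyEq (Eventually.of_forall hLs)), fun v => by simp⟩
  have hdet := eventually_det_eq hφ hsub hσ hσ0 hρ hρ0 hb x
  have hlog : ∀ᶠ u in 𝓝 (extChartAt (𝓡 m) x x), Real.log (LinearMap.det
      ((metricInChart g x u).inverse.comp (metricInChart g' x u)).toLinearMap) =
      2 * (((n : ℝ) - m) * Real.log (r u) - n * Real.log (s u)) := by
    filter_upwards [hdet] with u hu
    have hs2 := pow_ne_zero 2 (hs0 u)
    have hr2 := pow_ne_zero 2 (hr0 u)
    change _ * (s u ^ 2) ^ n * (r u ^ 2) ^ m = (r u ^ 2) ^ n at hu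
    have hd0 : LinearMap.det ((metricInChart g x u).inverse.comp
        (metricInChart g' x u)).toLinearMap ≠ 0 := by
      intro h0
      rw [h0, zero_mul, zero_mul] at hu
      exact pow_ne_zero n hr2 hu.symm
    have h1 := congrArg Real.log hu
    rw [Real.log_mul (mul_ne_zero hd0 (pow_ne_zero n hs2)) (pow_ne_zero m hr2),
      Real.log_mul hd0 (pow_ne_zero n hs2)] at h1
    simp only [Real.log_pow, Nat.cast_ofNat] at h1
    linarith
  have hG := eventually_isMetricForm_metricInChart g x
  have hG' := eventually_isMetricForm_metricInChart g' x
  have hc := (contDiffAt_metricInChart g x).of_le (m := 1) (by norm_cast)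
  have hc' := (contDiffAt_metricInChart g' x).of_le (m := 1) (by norm_cast)
  have hGd := (hc.differentiableAt one_ne_zero).hasFDerivAt
  have hGd' := (hc'.differentiableAt one_ne_zero).hasFDerivAt
  have hTd : HasFDerivAt (fderiv ℝ (mapInChart (n := n) φ x)) _ (extChartAt (𝓡 m) x x) :=
    (((contDiffAt_mapInChart hφ x).fderiv_right (m := 1) (by norm_cast)).differentiableAt
      one_ne_zero).hasFDerivAt
  have hθ := logVolumeDeriv_eq_add hG hG'.self_of_nhds hc hGd hGd' hld hlog
  have hed : ∀ g : Metric m M,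
      HasFDerivAt (fun u => energyDensity g h φ ((extChartAt (𝓡 m) x).symm u))
        (dfun (energyDensity g h φ) x) (extChartAt (𝓡 m) x x) := by
    intro g
    have h1 := (differentiableAt_energyDensity g h hφ x).hasFDerivAt
    have h2 := dfun_eq_of_hasFDerivAt h1
    exact h2 ▸ h1
  -- The two divergences share the map, its derivatives and the target connection; only the source
  -- metric, the energy density and the Cauchy-Green tensor differ.
  obtain ⟨dQ, hQ, hτ⟩ := sigmaTwoTensionIn_eq_stressDivergence (christoffelLinear h (φ x))
    hG hc hGd hTd (hed g) (differentiableAt_endoInChart_cauchyGreen g h hφ x).hasFDerivAt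
  obtain ⟨dQ', hQ', hτ'⟩ := sigmaTwoTensionIn_eq_stressDivergence (christoffelLinear h (φ x))
    hG' hc' hGd' hTd (hed g') (differentiableAt_endoInChart_cauchyGreen g' h hφ x).hasFDerivAt
  have hstress : ∀ᶠ z in 𝓝 (extChartAt (𝓡 m) x x),
      sigmaTwoStress (metricInChart g' x z) (fderiv ℝ (mapInChart (n := n) φ x) z)
        (energyDensity g' h φ ((extChartAt (𝓡 m) x).symm z))
        (endoInChart (cauchyGreen g' h φ) x z) =
      s z ^ 4 • sigmaTwoStress (metricInChart g x z) (fderiv ℝ (mapInChart (n := n) φ x) z)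
        (energyDensity g h φ ((extChartAt (𝓡 m) x).symm z))
        (endoInChart (cauchyGreen g h φ) x z) := by
    filter_upwards [mapDomain_mem_nhds (m := m) (n := n) hφ.continuous x] with z hz
    have hbz := isBiconformalForm_metricInChart hφ hb hz
    have hGz := isMetricForm_metricInChart g x hz.1
    have hGz' := isMetricForm_metricInChart g' x hz.1
    have hC := endoInChart_cauchyGreen g h hφ hz
    have hC' := endoInChart_cauchyGreen g' h hφ hz
    have hCC := hbz.inverse_comp_formPullback hGz hGz' (hσ0 _) (hρ0 _)
      (metricInChart h (φ x) (mapInChart (n := n) φ x z))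
    have he : energyDensity g' h φ ((extChartAt (𝓡 m) x).symm z) =
        s z ^ 2 * energyDensity g h φ ((extChartAt (𝓡 m) x).symm z) := by
      rw [energyDensity_eq g' h φ hz.1, energyDensity_eq g h φ hz.1, hC, hC', pullbackInChart,
        hCC, ContinuousLinearMap.toLinearMap_smul, map_smul, smul_eq_mul]
      ring
    rw [he, hC, hC']
    exact hbz.sigmaTwoStress_eq hGz hGz' (hσ0 _) (hρ0 _) _ _
  have hs4 : HasFDerivAt (fun z => s z ^ 4)
      ((4 * s (extChartAt (𝓡 m) x x) ^ 3) • fderiv ℝ s (extChartAt (𝓡 m) x x))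
      (extChartAt (𝓡 m) x x) := by
    simpa using hsd.pow 4
  -- The derivative `4 s³ ds` is `s⁴ · 4 d log s`, which completes the density term `dl` to `dL`.
  have hdl : ∀ v, s (extChartAt (𝓡 m) x x) ^ 4 * logVolumeDeriv
        (metricInChart g' x (extChartAt (𝓡 m) x x))
        (fderiv ℝ (metricInChart g' x) (extChartAt (𝓡 m) x x)) v +
        ((4 * s (extChartAt (𝓡 m) x x) ^ 3) • fderiv ℝ s (extChartAt (𝓡 m) x x)) v =
      s (extChartAt (𝓡 m) x x) ^ 4 * (logVolumeDeriv (metricInChart g x (extChartAt (𝓡 m) x x))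
        (fderiv ℝ (metricInChart g x) (extChartAt (𝓡 m) x x)) v +
        dL v) := by
    intro v
    rw [hθ v, hdLv v, smul_apply, smul_eq_mul]
    have := hs0 (extChartAt (𝓡 m) x x)
    field_simp
    ring
  have hfin := stressDivergence_congr hQ hQ' hs4 hstress
    (fderiv ℝ (mapInChart (n := n) φ x) (extChartAt (𝓡 m) x x)) (christoffelLinear h (φ x)) hdl
  rw [← hτ, ← hτ'] at hfin
  simp only [s, extChartAt_to_inv] at hfin
  have hgrad : grad g L x = (metricInChart g x (extChartAt (𝓡 m) x x)).inverse dL := by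
    rw [← hdL]
    exact sharp_eq_inverse g x _
  have h1 : diff φ x (grad g L x) = fderiv ℝ (mapInChart (n := n) φ x) (extChartAt (𝓡 m) x x)
      ((metricInChart g x (extChartAt (𝓡 m) x x)).inverse dL) :=
    (diff_eq_fderiv hφ x _).trans (congrArg _ hgrad)
  have h2 : diff φ x (weightedGrad g h φ L x) =
      fderiv ℝ (mapInChart (n := n) φ x) (extChartAt (𝓡 m) x x)
        (endoInChart (cauchyGreen g h φ) x (extChartAt (𝓡 m) x x)
          ((metricInChart g x (extChartAt (𝓡 m) x x)).inverse dL)) := by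
    rw [weightedGrad_eq_cauchyGreen, ← endoInChart_self (cauchyGreen g h φ)]
    exact (diff_eq_fderiv hφ x _).trans (congrArg _ (congrArg _ hgrad))
  have h3 : sigmaTwoStress (metricInChart g x (extChartAt (𝓡 m) x x))
      (fderiv ℝ (mapInChart (n := n) φ x) (extChartAt (𝓡 m) x x)) (energyDensity g h φ x)
      (endoInChart (cauchyGreen g h φ) x (extChartAt (𝓡 m) x x)) dL =
      (2 * energyDensity g h φ x) •
        fderiv ℝ (mapInChart (n := n) φ x) (extChartAt (𝓡 m) x x)
          ((metricInChart g x (extChartAt (𝓡 m) x x)).inverse dL) -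
        fderiv ℝ (mapInChart (n := n) φ x) (extChartAt (𝓡 m) x x)
        (endoInChart (cauchyGreen g h φ) x (extChartAt (𝓡 m) x x)
          ((metricInChart g x (extChartAt (𝓡 m) x x)).inverse dL)) := by
    simp [sigmaTwoStress]
  refine (sigmaTwoTension_eq g' h hφ x).trans (hfin.trans ?_)
  rw [h3, ← add_sub_assoc, h1, h2, sigmaTwoTension_eq g h hφ]
  rfl

end Main

end SigmaTwo

end

theorem mainTheorem7 {m n : ℕ}
    {M : Type*} [TopologicalSpace M] [ChartedSpace (EuclideanSpace ℝ (Fin m)) M]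
    [IsManifold (𝓡 m) ∞ M]
    {N : Type*} [TopologicalSpace N] [ChartedSpace (EuclideanSpace ℝ (Fin n)) N]
    [IsManifold (𝓡 n) ∞ N]
    (g : SigmaTwo.Metric m M) (h : SigmaTwo.Metric n N)
    (φ : M → N) (hφ : ContMDiff (𝓡 m) (𝓡 n) ∞ φ)
    (hsub : SigmaTwo.IsAlmostSubmersion (m := m) (n := n) φ)
    (σ : M → ℝ) (hσ : ContMDiff (𝓡 m) 𝓘(ℝ, ℝ) ∞ σ) (hσ0 : ∀ x, σ x ≠ 0) :
    (∀ ρ : M → ℝ, ContMDiff (𝓡 m) 𝓘(ℝ, ℝ) ∞ ρ → (∀ x, ρ x ≠ 0) →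
      ∀ g' : SigmaTwo.Metric m M,
        SigmaTwo.IsBiconformalChange (n := n) g g' φ σ ρ →
        ∀ x : M,
          SigmaTwo.sigmaTwoTension g' h φ x =
            (σ x ^ 4) • (SigmaTwo.sigmaTwoTension g h φ x
              + (2 * SigmaTwo.energyDensity g h φ x) •
                SigmaTwo.diff φ x (SigmaTwo.grad g
                  (fun y => Real.log |σ y ^ (4 - (n : ℤ)) * ρ y ^ ((n : ℤ) - (m : ℤ))|) x)
              - SigmaTwo.diff φ x (SigmaTwo.weightedGrad g h φ
                  (fun y => Real.log |σ y ^ (4 - (n : ℤ)) * ρ y ^ ((n : ℤ) - (m : ℤ))|) x))) ∧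
    (∀ g' : SigmaTwo.Metric m M,
      (∀ (x : M) (v w : TangentSpace (𝓡 m) x),
        g'.inner x v w = (σ x ^ 2)⁻¹ * g.inner x v w) →
      ∀ x : M,
        SigmaTwo.sigmaTwoTension g' h φ x =
          (σ x ^ 4) • (SigmaTwo.sigmaTwoTension g h φ x
            + (2 * SigmaTwo.energyDensity g h φ x) •
              SigmaTwo.diff φ x (SigmaTwo.grad g
                (fun y => Real.log |σ y ^ (4 - (m : ℤ))|) x)
            - SigmaTwo.diff φ x (SigmaTwo.weightedGrad g h φ
                (fun y => Real.log |σ y ^ (4 - (m : ℤ))|) x))) := by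
  refine ⟨fun ρ hρ hρ0 g' hb x =>
    SigmaTwo.sigmaTwoTension_biconformal hφ hsub hσ hσ0 hρ hρ0 hb h x, fun g' hg' x => ?_⟩
  -- A conformal change is biconformal with `ρ = σ`: the mixed products vanish by orthogonality. The
  -- exponents `4 - n` and `n - m` then add up to `4 - m`.
  have hb : SigmaTwo.IsBiconformalChange (n := n) g g' φ σ σ := by
    intro y a ha b hb c hc d hd
    simp only [SigmaTwo.horizontal, Submodule.mem_iInf] at ha hb
    have h1 : g.inner y c b = 0 := hb c hc
    have h2 : g.inner y a d = 0 := (g.symm y a d).trans (ha d hd)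
    simp only [hg', map_add, add_apply, h1, h2]
    ring
  have hL : ∀ y, σ y ^ (4 - (n : ℤ)) * σ y ^ ((n : ℤ) - (m : ℤ)) = σ y ^ (4 - (m : ℤ)) := by
    intro y
    rw [← zpow_add₀ (hσ0 y)]
    congr 1
    ring
  have h1 := SigmaTwo.sigmaTwoTension_biconformal hφ hsub hσ hσ0 hσ hσ0 hb h x
  simp only [hL] at h1
  exact h1
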